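/- Let $\alpha\in\mathbb R$, let $r,a,b,q$ be integers with $q\ge 1$ and $ar+bq=1$, put $\varepsilon=r/q-\alpha$, assume $\varepsilon\neq0$, and put $\theta=(a\alpha+b)/(-q\alpha+r)$. Let $\tau\in\mathbb C$ with $\Im\tau>0$. For real $\vartheta$ let $\mathcal A_\vartheta$ be the unital $*$-algebra of series $\sum_{(m,n)\in\mathbb Z^2}c_{mn}U_1^mU_2^n$ with rapidly decreasing complex coefficients, where $U_1,U_2$ are unitary and $U_2U_1=e^{2\pi i\vartheta}U_1U_2$; the generators of $\mathcal A_\alpha$ are written $Z_1,Z_2$. Let $\partial_1,\partial_2$ be the derivations with $\partial_\mu U_\nu=2\pi i\,\delta_{\mu\nu}U_\nu$, and $\partial_{(\tau)}=\frac{1}{\tau-\bar\tau}(-\bar\tau\partial_1+\partial_2)$, $\bar\partial_{(\tau)}=\frac{1}{\tau-\bar\tau}(\tau\partial_1-\partial_2)$. Let $\mathcal E_{r,q}=\mathcal S(\mathbb R\times\mathbb Z_q)$, with the right action of $\mathcal A_\alpha$ given by $$(\xi Z_1)(s,k)=\xi(s-\varepsilon,k-r),\qquad (\xi Z_2)(s,k)=e^{2\pi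 i(s-k/q)}\xi(s,k),$$ the left action of $\mathcal A_\theta$ given by $$(U_1\xi)(s,k)=\xi(s-1/q,k-1),\qquad (U_2\xi)(s,k)=e^{2\pi i(s/\varepsilon-ak)/q}\xi(s,k),$$ and the $\mathcal A_\alpha$-valued hermitian structure $$\langle\xi,\eta\rangle_\alpha=\sum_{m,n}\Big(\sum_{k\in\mathbb Z_q}\int_{\mathbb R}\overline{\xi(s-m\varepsilon,k-mr)}\,\eta(s,k)\,e^{-2\pi in(s-k/q)}\,ds\Big)Z_1^mZ_2^n .$$ Let $(\nabla_1\xi)(s,k)=\frac{2\pi i}{\varepsilon}s\,\xi(s,k)$, $(\nabla_2\xi)(s,k)=\frac{d\xi}{ds}(s,k)$ be the constant curvature connection and $\bar\nabla=\frac{1}{\tau-\bar\tau}(\tau\nabla_1-\nabla_2)$. Let $\psi\in\mathcal E_{r,q}$ be such that $\langle\psi,\psi\rangle_\alpha$ is invertible in $\mathcal A_\alpha$. Then there is exactly one element $p_\psi\in\mathcal A_\theta$ that acts on $\mathcal E_{r,q}$ as $|\psi\rangle\langle\psi,\psi\rangle_\alpha^{-1}\langle\psi|$, i.e. $p_\psi\eta=\psi\,\big(\langle\psi,\psi\rangle_\alpha^{-1}\langle\psi,\eta\rangle_\alpha\big)$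 for all $\eta\in\mathcal E_{r,q}$. It is a projection, $p_\psi^2=p_\psi=p_\psi^*$, and each of the two forms $$\bar\partial_{(\tau)}(p_\psi)\,p_\psi=0,\qquad p_\psi\,\partial_{(\tau)}(p_\psi)=0$$ of the self-duality equation holds if and only if there is $\lambda\in\mathcal A_\alpha$ with $\bar\nabla\psi-\psi\lambda=0$. -/

import Mathlib

open scoped SchwartzMap ComplexConjugate ContDiff

noncomputable section

namespace NCSigma

/-! ### The smooth noncommutative torus -/

/-- The weight `1 + |m| + |n|` on `ℤ²`. -/
def weight (p : ℤ × ℤ) : ℝ := 1 + |(p.1 : ℝ)| + |(p.2 : ℝ)|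

theorem one_le_weight (p : ℤ × ℤ) : 1 ≤ weight p := by
  unfold weight
  have := abs_nonneg (p.1 : ℝ)
  have := abs_nonneg (p.2 : ℝ)
  linarith

theorem weight_pos (p : ℤ × ℤ) : 0 < weight p := lt_of_lt_of_le one_pos (one_le_weight p)

theorem weight_neg (p : ℤ × ℤ) : weight (-p) = weight p := by
  simp [weight]

theorem weight_le_mul (x p : ℤ × ℤ) : weight p ≤ weight x * weight (p - x) := by
  unfold weight
  have h1 : |(p.1 : ℝ)| ≤ |(x.1 : ℝ)| + |((p - x).1 : ℝ)| := by
    have := abs_add_le (x.1 : ℝ) ((p - x).1 : ℝ)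
    simpa using this
  have h2 : |(p.2 : ℝ)| ≤ |(x.2 : ℝ)| + |((p - x).2 : ℝ)| := by
    have := abs_add_le (x.2 : ℝ) ((p - x).2 : ℝ)
    simpa using this
  nlinarith [abs_nonneg (x.1 : ℝ), abs_nonneg (x.2 : ℝ), abs_nonneg ((p - x).1 : ℝ),
    abs_nonneg ((p - x).2 : ℝ)]

/-- A function on `ℤ²` decays rapidly: it is bounded by every negative power of the weight. -/
def RapidDecay (a : ℤ × ℤ → ℂ) : Prop :=
  ∀ k : ℕ, ∃ C : ℝ, ∀ p, weight p ^ k * ‖a p‖ ≤ C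

/-- The space of Schwartz functions on `ℤ²`. -/
def rapidSeq : Submodule ℂ (ℤ × ℤ → ℂ) where
  carrier := {a | RapidDecay a}
  zero_mem' := fun k => ⟨0, fun p => by simp⟩
  add_mem' := by
    intro a b ha hb k
    obtain ⟨C, hC⟩ := ha k
    obtain ⟨D, hD⟩ := hb k
    refine ⟨C + D, fun p => ?_⟩
    have hw := pow_pos (weight_pos p) k
    calc weight p ^ k * ‖(a + b) p‖ ≤ weight p ^ k * (‖a p‖ + ‖b p‖) := by
          gcongr; exact norm_add_le _ _
      _ ≤ C + D := by rw [mul_add]; exact add_le_add (hC p) (hD p)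
  smul_mem' := by
    intro c a ha k
    obtain ⟨C, hC⟩ := ha k
    refine ⟨‖c‖ * C, fun p => ?_⟩
    have := mul_le_mul_of_nonneg_left (hC p) (norm_nonneg c)
    calc weight p ^ k * ‖(c • a) p‖ = ‖c‖ * (weight p ^ k * ‖a p‖) := by simp; ring
      _ ≤ _ := this

/-- Summability over `ℤ²` of the fourth negative power of the weight. -/
theorem summable_weight : Summable fun p : ℤ × ℤ => (weight p ^ 4)⁻¹ := by
  have h1 : Summable fun n : ℤ => ((1 + |(n : ℝ)|) ^ 2)⁻¹ := by
    have h0 : Summable fun n : ℤ => 1 / (n : ℝ) ^ 2 :=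
      Real.summable_one_div_int_pow.mpr one_lt_two
    have h0' : Summable fun n : ℤ => 1 / (n : ℝ) ^ 2 + if n = 0 then (1 : ℝ) else 0 :=
      h0.add (summable_of_ne_finset_zero (s := {0}) (by intro b hb; simp at hb; simp [hb]))
    refine Summable.of_nonneg_of_le (fun n => by positivity) (fun n => ?_) h0'
    by_cases hn : n = 0
    · simp [hn]
    · simp only [hn, if_false, add_zero, one_div]
      have : 0 < |(n : ℝ)| := by simpa using hn
      rw [← sq_abs (n : ℝ)]
      gcongr
      linarith
  refine Summable.of_nonneg_of_le (fun p => by have := weight_pos p; positivity) (fun p => ?_)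
    (h1.mul_of_nonneg h1 (fun n => by positivity) (fun n => by positivity))
  rw [← mul_inv]
  have hx := abs_nonneg (p.1 : ℝ)
  have hy := abs_nonneg (p.2 : ℝ)
  gcongr
  rw [← mul_pow, show 4 = 2 * 2 from rfl, pow_mul]
  gcongr
  unfold weight
  nlinarith

theorem RapidDecay.summable {a : ℤ × ℤ → ℂ} (ha : RapidDecay a) (k : ℕ) :
    Summable fun p => weight p ^ k * ‖a p‖ := by
  obtain ⟨C, hC⟩ := ha (k + 4)
  refine Summable.of_nonneg_of_le (fun p => by have := weight_pos p; positivity) (fun p => ?_)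
    (summable_weight.mul_left C)
  have := weight_pos p
  rw [← div_eq_mul_inv, le_div_iff₀ (by positivity)]
  calc _ = weight p ^ (k + 4) * ‖a p‖ := by ring
    _ ≤ C := hC p

theorem RapidDecay.summable_norm {a : ℤ × ℤ → ℂ} (ha : RapidDecay a) :
    Summable fun p => ‖a p‖ := by simpa using ha.summable 0

/-- `e(x) = exp(2πi x)`. -/
def e (x : ℝ) : ℂ := Complex.exp (2 * Real.pi * Complex.I * x)

theorem e_add (x y : ℝ) : e (x + y) = e x * e y := by
  simp only [e, ← Complex.exp_add]; congr 1; push_cast; ring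

theorem e_zero : e 0 = 1 := by simp [e]

theorem norm_e (x : ℝ) : ‖e x‖ = 1 := by
  rw [e, show 2 * (Real.pi : ℂ) * Complex.I * x = ((2 * Real.pi * x : ℝ) : ℂ) * Complex.I by
    push_cast; ring]
  exact Complex.norm_exp_ofReal_mul_I _

/-- The algebra `A_θ` of smooth functions on the noncommutative torus: the series
`∑ a (m, n) U₁ᵐ U₂ⁿ` with rapidly decaying coefficients, where `U₂ U₁ = e(θ) U₁ U₂`. -/
def NCTorus (_θ : ℝ) : Type := rapidSeq

namespace NCTorus

variable {θ : ℝ}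

instance : AddCommGroup (NCTorus θ) := inferInstanceAs (AddCommGroup rapidSeq)
instance : Module ℂ (NCTorus θ) := inferInstanceAs (Module ℂ rapidSeq)

/-- The coefficient of `U₁ᵐ U₂ⁿ`, for `p = (m, n)`. -/
def coeff (a : NCTorus θ) (p : ℤ × ℤ) : ℂ := a.1 p

/-- The element with given rapidly decaying coefficients. -/
def mk (a : ℤ × ℤ → ℂ) (ha : RapidDecay a) : NCTorus θ := ⟨a, ha⟩

theorem rapid (a : NCTorus θ) : RapidDecay a.coeff := a.2

@[simp] theorem coeff_mk (a : ℤ × ℤ → ℂ) (ha : RapidDecay a) : (mk a ha : NCTorus θ).coeff = a :=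
  rfl

theorem ext {a b : NCTorus θ} (h : ∀ p, a.coeff p = b.coeff p) : a = b :=
  Subtype.ext (funext h)

@[simp] theorem coeff_zero (p : ℤ × ℤ) : (0 : NCTorus θ).coeff p = 0 := rfl
@[simp] theorem coeff_add (a b : NCTorus θ) (p : ℤ × ℤ) :
    (a + b).coeff p = a.coeff p + b.coeff p := rfl
@[simp] theorem coeff_sub (a b : NCTorus θ) (p : ℤ × ℤ) :
    (a - b).coeff p = a.coeff p - b.coeff p := rfl
@[simp] theorem coeff_smul (c : ℂ) (a : NCTorus θ) (p : ℤ × ℤ) :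
    (c • a).coeff p = c * a.coeff p := rfl

/-- The terms of the product: `(U₁ⁱ U₂ʲ) (U₁^(m - i) U₂^(n - j)) = e(θ j (m - i)) U₁ᵐ U₂ⁿ`. -/
def mulTerm (θ : ℝ) (a b : ℤ × ℤ → ℂ) (p x : ℤ × ℤ) : ℂ :=
  a x * b (p - x) * e (θ * (x.2 * (p.1 - x.1)))

theorem norm_mulTerm (a b : ℤ × ℤ → ℂ) (p x : ℤ × ℤ) :
    ‖mulTerm θ a b p x‖ = ‖a x‖ * ‖b (p - x)‖ := by
  simp [mulTerm, norm_e]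

theorem summable_mulTerm (a b : NCTorus θ) (p : ℤ × ℤ) :
    Summable (mulTerm θ a.coeff b.coeff p) := by
  obtain ⟨C, hC⟩ := b.rapid 0
  refine Summable.of_norm_bounded (a.rapid.summable_norm.mul_right C) (fun x => ?_)
  rw [norm_mulTerm]
  have := hC (p - x)
  gcongr
  simpa using this

theorem rapidDecay_mul (a b : NCTorus θ) :
    RapidDecay fun p => ∑' x, mulTerm θ a.coeff b.coeff p x := by
  intro k
  obtain ⟨C, hC⟩ := b.rapid k
  refine ⟨∑' x, weight x ^ k * ‖a.coeff x‖ * C, fun p => ?_⟩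
  have hw := pow_pos (weight_pos p) k
  have hs := (summable_mulTerm a b p).norm
  calc weight p ^ k * ‖∑' x, mulTerm θ a.coeff b.coeff p x‖
      ≤ weight p ^ k * ∑' x, ‖mulTerm θ a.coeff b.coeff p x‖ := by
        gcongr; exact norm_tsum_le_tsum_norm hs
    _ = ∑' x, weight p ^ k * ‖mulTerm θ a.coeff b.coeff p x‖ := by rw [tsum_mul_left]
    _ ≤ _ := by
        refine Summable.tsum_le_tsum (fun x => ?_) (hs.mul_left _) ((a.rapid.summable k).mul_right C)
        rw [norm_mulTerm]
        have h1 : weight p ^ k ≤ weight x ^ k * weight (p - x) ^ k := by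
          rw [← mul_pow]
          exact pow_le_pow_left₀ (weight_pos p).le (weight_le_mul x p) k
        have h2 : 0 ≤ weight x ^ k * ‖a.coeff x‖ :=
          mul_nonneg (pow_pos (weight_pos x) k).le (norm_nonneg _)
        calc weight p ^ k * (‖a.coeff x‖ * ‖b.coeff (p - x)‖)
            ≤ (weight x ^ k * weight (p - x) ^ k) * (‖a.coeff x‖ * ‖b.coeff (p - x)‖) := by gcongr
          _ = weight x ^ k * ‖a.coeff x‖ * (weight (p - x) ^ k * ‖b.coeff (p - x)‖) := by ring
          _ ≤ _ := by gcongr; exact hC _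

instance : Mul (NCTorus θ) :=
  ⟨fun a b => mk (fun p => ∑' x, mulTerm θ a.coeff b.coeff p x) (rapidDecay_mul a b)⟩

theorem coeff_mul (a b : NCTorus θ) (p : ℤ × ℤ) :
    (a * b).coeff p =
      ∑' x : ℤ × ℤ, a.coeff x * b.coeff (p - x) * e (θ * (x.2 * (p.1 - x.1))) := rfl

instance : One (NCTorus θ) :=
  ⟨mk (fun p => if p = 0 then 1 else 0) (fun k => ⟨1, fun p => by
    by_cases h : p = 0
    · simp [h, weight]
    · simp [h]⟩)⟩

theorem coeff_one (p : ℤ × ℤ) : (1 : NCTorus θ).coeff p = if p = 0 then 1 else 0 := rfl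

protected theorem mul_assoc (a b c : NCTorus θ) : a * b * c = a * (b * c) := by
  refine ext fun p => ?_
  obtain ⟨C, hC⟩ := c.rapid 0
  let F : ℤ × ℤ → ℤ × ℤ → ℂ := fun x z => a.coeff x * b.coeff z * c.coeff (p - x - z) *
    (e (θ * (x.2 * (p.1 - x.1))) * e (θ * (z.2 * (p.1 - x.1 - z.1))))
  have hF : Summable fun q : (ℤ × ℤ) × (ℤ × ℤ) => F q.1 q.2 := by
    refine Summable.of_norm_bounded ((a.rapid.summable_norm.mul_of_nonneg b.rapid.summable_norm
      (fun _ => norm_nonneg _) (fun _ => norm_nonneg _)).mul_right C) (fun q => ?_)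
    have := hC (p - q.1 - q.2)
    simp only [F, norm_mul, norm_e, mul_one]
    gcongr
    simpa using this
  have hR : (a * (b * c)).coeff p = ∑' x, ∑' z, F x z := by
    rw [coeff_mul]
    refine tsum_congr fun x => ?_
    rw [coeff_mul, ← tsum_mul_left, ← tsum_mul_right]
    refine tsum_congr fun z => ?_
    simp only [F, Prod.fst_sub]
    push_cast
    ring
  have hL : (a * b * c).coeff p = ∑' y, ∑' x, F x (y - x) := by
    rw [coeff_mul]
    refine tsum_congr fun y => ?_
    rw [coeff_mul, ← tsum_mul_right, ← tsum_mul_right]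
    refine tsum_congr fun x => ?_
    have h1 : p - x - (y - x) = p - y := by abel
    have h2 : e (θ * (x.2 * (y.1 - x.1))) * e (θ * (y.2 * (p.1 - y.1))) =
        e (θ * (x.2 * (p.1 - x.1))) *
          e (θ * (((y - x).2 : ℤ) * (p.1 - x.1 - ((y - x).1 : ℤ)))) := by
      rw [← e_add, ← e_add]
      congr 1
      simp only [Prod.fst_sub, Prod.snd_sub]
      push_cast
      ring
    simp only [F, h1]
    rw [← h2]
    ring
  let E : (ℤ × ℤ) × (ℤ × ℤ) ≃ (ℤ × ℤ) × (ℤ × ℤ) :=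
    { toFun := fun q => (q.1, q.2 - q.1)
      invFun := fun q => (q.1, q.2 + q.1)
      left_inv := fun q => by simp
      right_inv := fun q => by simp }
  have hG : Summable (Function.uncurry fun x y : ℤ × ℤ => F x (y - x)) :=
    (E.summable_iff (f := fun q : (ℤ × ℤ) × (ℤ × ℤ) => F q.1 q.2)).mpr hF
  rw [hL, hR, hG.tsum_comm]
  refine tsum_congr fun x => ?_
  exact (Equiv.subRight x).tsum_eq (fun z => F x z)

instance : Ring (NCTorus θ) :=
  { (inferInstance : AddCommGroup (NCTorus θ)) with
    mul := (· * ·)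
    one := 1
    mul_assoc := NCTorus.mul_assoc
    left_distrib := fun a b c => ext fun p => by
      refine Eq.trans (tsum_congr fun x => ?_)
        ((summable_mulTerm a b p).tsum_add (summable_mulTerm a c p))
      simp only [coeff_add, mulTerm]; ring
    right_distrib := fun a b c => ext fun p => by
      refine Eq.trans (tsum_congr fun x => ?_)
        ((summable_mulTerm a c p).tsum_add (summable_mulTerm b c p))
      simp only [coeff_add, mulTerm]; ring
    zero_mul := fun a => ext fun p => by rw [coeff_mul]; simp
    mul_zero := fun a => ext fun p => by rw [coeff_mul]; simp
    one_mul := fun a => ext fun p => by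
      rw [coeff_mul, tsum_eq_single 0 (fun x hx => by simp [coeff_one, hx])]
      simp [coeff_one, e_zero]
    mul_one := fun a => ext fun p => by
      rw [coeff_mul, tsum_eq_single p (fun x hx => by
        simp [coeff_one, sub_eq_zero, Ne.symm hx])]
      simp [coeff_one, e_zero] }

/-- The adjoint, with `U₁`, `U₂` unitary: `(U₁ᵐ U₂ⁿ)* = U₂⁻ⁿ U₁⁻ᵐ = e(θ m n) U₁⁻ᵐ U₂⁻ⁿ`. -/
instance : Star (NCTorus θ) :=
  ⟨fun a => mk (fun p => conj (a.coeff (-p)) * e (θ * (p.1 * p.2))) (fun k => by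
    obtain ⟨C, hC⟩ := a.rapid k
    refine ⟨C, fun p => ?_⟩
    have := hC (-p)
    rw [weight_neg] at this
    simpa [norm_e] using this)⟩

theorem coeff_star (a : NCTorus θ) (p : ℤ × ℤ) :
    (star a).coeff p = conj (a.coeff (-p)) * e (θ * (p.1 * p.2)) := rfl

theorem rapidDecay_mul_of_le (a : NCTorus θ) (c : ℤ × ℤ → ℂ) (K : ℝ)
    (hc : ∀ p, ‖c p‖ ≤ K * weight p) : RapidDecay fun p => c p * a.coeff p := by
  intro k
  obtain ⟨C, hC⟩ := a.rapid (k + 1)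
  have hK : 0 ≤ K := by
    have h := (norm_nonneg _).trans (hc 0)
    have := weight_pos 0
    by_contra hn
    push Not at hn
    nlinarith
  refine ⟨K * C, fun p => ?_⟩
  have hw := pow_pos (weight_pos p) k
  calc weight p ^ k * ‖c p * a.coeff p‖ ≤ weight p ^ k * (K * weight p * ‖a.coeff p‖) := by
        rw [norm_mul]; gcongr; exact hc p
    _ = K * (weight p ^ (k + 1) * ‖a.coeff p‖) := by ring
    _ ≤ K * C := by gcongr; exact hC p

/-- The derivation `∂₁`, with `∂₁ U₁ = 2πi U₁` and `∂₁ U₂ = 0`. -/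
def partial₁ (a : NCTorus θ) : NCTorus θ :=
  mk (fun p => 2 * Real.pi * Complex.I * p.1 * a.coeff p)
    (rapidDecay_mul_of_le a _ (2 * Real.pi) fun p => by
      simp only [weight, norm_mul, Complex.norm_I, Complex.norm_intCast, Complex.norm_ofNat,
        Complex.norm_real, Real.norm_eq_abs, abs_of_pos Real.pi_pos, mul_one]
      gcongr
      linarith [abs_nonneg (p.2 : ℝ)])

/-- The derivation `∂₂`, with `∂₂ U₁ = 0` and `∂₂ U₂ = 2πi U₂`. -/
def partial₂ (a : NCTorus θ) : NCTorus θ :=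
  mk (fun p => 2 * Real.pi * Complex.I * p.2 * a.coeff p)
    (rapidDecay_mul_of_le a _ (2 * Real.pi) fun p => by
      simp only [weight, norm_mul, Complex.norm_I, Complex.norm_intCast, Complex.norm_ofNat,
        Complex.norm_real, Real.norm_eq_abs, abs_of_pos Real.pi_pos, mul_one]
      gcongr
      linarith [abs_nonneg (p.1 : ℝ)])

/-- The holomorphic derivation `∂_(τ) = (τ - τ̄)⁻¹ (-τ̄ ∂₁ + ∂₂)`. -/
def del (τ : ℂ) (a : NCTorus θ) : NCTorus θ :=
  (τ - conj τ)⁻¹ • (-(conj τ • partial₁ a) + partial₂ a)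

/-- The antiholomorphic derivation `∂̄_(τ) = (τ - τ̄)⁻¹ (τ ∂₁ - ∂₂)`. -/
def delBar (τ : ℂ) (a : NCTorus θ) : NCTorus θ :=
  (τ - conj τ)⁻¹ • (τ • partial₁ a - partial₂ a)

end NCTorus

/-! ### Operations on Schwartz functions of one real variable -/

/-- The sum of a series of Schwartz functions that converges absolutely in every seminorm. -/
def schwartzSum {ι : Type*} (F : ι → 𝓢(ℝ, ℂ))
    (hF : ∀ k l : ℕ, Summable fun i => SchwartzMap.seminorm ℂ k l (F i)) : 𝓢(ℝ, ℂ) where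
  toFun s := ∑' i, F i s
  smooth' := contDiff_tsum (fun i => (F i).smooth') (fun k _ => hF 0 k)
    (fun k i x _ => SchwartzMap.norm_iteratedFDeriv_le_seminorm ℂ (F i) k x)
  decay' := by
    intro k l
    refine ⟨∑' i, SchwartzMap.seminorm ℂ k l (F i), fun x => ?_⟩
    rw [iteratedFDeriv_tsum_apply (f := fun i => ⇑(F i)) (N := ⊤) (v := fun j i => SchwartzMap.seminorm ℂ 0 j (F i))
      (fun i => (F i).smooth') (fun j _ => hF 0 j)
      (fun j i x _ => SchwartzMap.norm_iteratedFDeriv_le_seminorm ℂ (F i) j x) le_top]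
    have hs : Summable fun i => ‖iteratedFDeriv ℝ l (F i) x‖ :=
      Summable.of_nonneg_of_le (fun i => norm_nonneg _)
        (fun i => SchwartzMap.norm_iteratedFDeriv_le_seminorm ℂ (F i) l x) (hF 0 l)
    calc ‖x‖ ^ k * ‖∑' i, iteratedFDeriv ℝ l (F i) x‖
        ≤ ‖x‖ ^ k * ∑' i, ‖iteratedFDeriv ℝ l (F i) x‖ := by
          gcongr; exact norm_tsum_le_tsum_norm hs
      _ = ∑' i, ‖x‖ ^ k * ‖iteratedFDeriv ℝ l (F i) x‖ := by rw [tsum_mul_left]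
      _ ≤ _ := (hs.mul_left _).tsum_le_tsum
          (fun i => SchwartzMap.le_seminorm ℂ k l (F i) x) (hF k l)

theorem schwartzSum_apply {ι : Type*} (F : ι → 𝓢(ℝ, ℂ))
    (hF : ∀ k l : ℕ, Summable fun i => SchwartzMap.seminorm ℂ k l (F i)) (s : ℝ) :
    schwartzSum F hF s = ∑' i, F i s := rfl

/-- Multiplication by the coordinate: `(mulX f)(s) = s f(s)`. -/
def mulX (f : 𝓢(ℝ, ℂ)) : 𝓢(ℝ, ℂ) := SchwartzMap.smulLeftCLM ℂ (fun s : ℝ => (s : ℂ)) f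

theorem mulX_apply (f : 𝓢(ℝ, ℂ)) (s : ℝ) : mulX f s = s * f s := by
  rw [mulX, SchwartzMap.smulLeftCLM_apply_apply (by fun_prop), smul_eq_mul]

theorem hasDerivAt_e (y s : ℝ) :
    HasDerivAt (fun s : ℝ => e (y * s)) (2 * Real.pi * Complex.I * y * e (y * s)) s := by
  have h1 : HasDerivAt (fun s : ℝ => 2 * Real.pi * Complex.I * ((y * s : ℝ) : ℂ))
      (2 * Real.pi * Complex.I * ((y * 1 : ℝ) : ℂ)) s :=
    (((hasDerivAt_id s).const_mul y).ofReal_comp).const_mul _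
  have := h1.cexp
  rw [mul_one, mul_comm (Complex.exp _)] at this
  exact this

theorem hasTemperateGrowth_e (y : ℝ) : (fun s : ℝ => e (y * s)).HasTemperateGrowth := by
  constructor
  · exact Complex.contDiff_exp.comp (contDiff_const.mul
      (Complex.ofRealCLM.contDiff.comp (contDiff_const.mul contDiff_id)))
  · intro n
    have h : iteratedDeriv n (fun s : ℝ => e (y * s)) =
        fun s => (2 * Real.pi * Complex.I * y) ^ n * e (y * s) := by
      induction n with
      | zero => simp
      | succ n ih =>
        rw [iteratedDeriv_succ, ih]
        funext s
        rw [((hasDerivAt_e y s).const_mul _).deriv]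
        ring
    refine ⟨0, ‖(2 * Real.pi * Complex.I * y : ℂ)‖ ^ n, fun x => ?_⟩
    rw [norm_iteratedFDeriv_eq_norm_iteratedDeriv, h]
    simp [norm_e]

/-- Translation followed by modulation: `(shiftMod x y f)(s) = e(y s) f(s - x)`. -/
def shiftMod (x y : ℝ) (f : 𝓢(ℝ, ℂ)) : 𝓢(ℝ, ℂ) :=
  SchwartzMap.smulLeftCLM ℂ (fun s : ℝ => e (y * s)) (f.compSubConstCLM ℂ x)

theorem shiftMod_apply (x y : ℝ) (f : 𝓢(ℝ, ℂ)) (s : ℝ) :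
    shiftMod x y f s = e (y * s) * f (s - x) := by
  rw [shiftMod, SchwartzMap.smulLeftCLM_apply_apply (hasTemperateGrowth_e y), smul_eq_mul,
    SchwartzMap.compSubConstCLM_apply]

theorem mulX_shiftMod (x y : ℝ) (f : 𝓢(ℝ, ℂ)) :
    mulX (shiftMod x y f) = shiftMod x y (mulX f) + (x : ℂ) • shiftMod x y f := by
  ext s
  simp only [mulX_apply, shiftMod_apply, add_apply, smul_apply,
    smul_eq_mul]
  push_cast
  ring

theorem deriv_shiftMod (x y : ℝ) (f : 𝓢(ℝ, ℂ)) :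
    SchwartzMap.derivCLM ℂ ℂ (shiftMod x y f) =
      shiftMod x y (SchwartzMap.derivCLM ℂ ℂ f) +
        (2 * Real.pi * Complex.I * y : ℂ) • shiftMod x y f := by
  ext s
  have h1 : HasDerivAt (fun s : ℝ => f (s - x)) (deriv f (s - x)) s :=
    (f.hasDerivAt (s - x)).comp_sub_const s x
  have h2 : (shiftMod x y f : ℝ → ℂ) = fun s => e (y * s) * f (s - x) :=
    funext (shiftMod_apply x y f)
  simp only [add_apply, smul_apply, smul_eq_mul, shiftMod_apply,
    SchwartzMap.derivCLM_apply]
  rw [h2, show deriv (fun s : ℝ => e (y * s) * f (s - x)) s = _ from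
    ((hasDerivAt_e y s).mul h1).deriv]
  ring

theorem seminorm_deriv_le (k l : ℕ) (f : 𝓢(ℝ, ℂ)) :
    SchwartzMap.seminorm ℂ k (l + 1) f ≤
      SchwartzMap.seminorm ℂ k l (SchwartzMap.derivCLM ℂ ℂ f) := by
  refine SchwartzMap.seminorm_le_bound' ℂ k (l + 1) f (apply_nonneg _ _) fun x => ?_
  rw [iteratedDeriv_succ']
  exact SchwartzMap.le_seminorm' ℂ k l (SchwartzMap.derivCLM ℂ ℂ f) x

theorem seminorm_mulX_le (k : ℕ) (f : 𝓢(ℝ, ℂ)) :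
    SchwartzMap.seminorm ℂ (k + 1) 0 f ≤ SchwartzMap.seminorm ℂ k 0 (mulX f) := by
  refine SchwartzMap.seminorm_le_bound' ℂ (k + 1) 0 f (apply_nonneg _ _) fun x => ?_
  have := SchwartzMap.le_seminorm' ℂ k 0 (mulX f) x
  simp only [iteratedDeriv_zero, mulX_apply, norm_mul, Complex.norm_real,
    Real.norm_eq_abs] at this ⊢
  calc |x| ^ (k + 1) * ‖f x‖ = |x| ^ k * (|x| * ‖f x‖) := by ring
    _ ≤ _ := this

/-- The seminorms of `shiftMod x y f` grow at most polynomially in `x` and `y`. -/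
theorem seminorm_shiftMod_le (l k : ℕ) (f : 𝓢(ℝ, ℂ)) :
    ∃ C : ℝ, 0 ≤ C ∧ ∀ x y : ℝ, SchwartzMap.seminorm ℂ k l (shiftMod x y f) ≤
      C * (1 + |x| + |y|) ^ (k + l) := by
  induction l generalizing k f with
  | zero =>
    induction k generalizing f with
    | zero =>
      refine ⟨SchwartzMap.seminorm ℂ 0 0 f, apply_nonneg _ _, fun x y => ?_⟩
      refine SchwartzMap.seminorm_le_bound' ℂ 0 0 _ (by simp [apply_nonneg]) fun s => ?_
      have := SchwartzMap.norm_le_seminorm ℂ f (s - x)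
      simpa [shiftMod_apply, norm_e] using this
    | succ k ih =>
      obtain ⟨C, hC0, hC⟩ := ih f
      obtain ⟨D, hD0, hD⟩ := ih (mulX f)
      refine ⟨C + D, by positivity, fun x y => ?_⟩
      have hx := abs_nonneg x
      have hy := abs_nonneg y
      refine (seminorm_mulX_le k _).trans ?_
      rw [mulX_shiftMod]
      refine (map_add_le_add _ _ _).trans ?_
      rw [map_smul_eq_mul]
      have h1 := hC x y
      have h2 := hD x y
      simp only [Complex.norm_real, Real.norm_eq_abs, add_zero] at *
      have hP : 0 ≤ (1 + |x| + |y|) ^ k := by positivity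
      calc _ ≤ D * (1 + |x| + |y|) ^ k * (1 + |x| + |y|) +
            (1 + |x| + |y|) * (C * (1 + |x| + |y|) ^ k) := by
            gcongr
            · refine h2.trans (le_mul_of_one_le_right (by positivity) (by linarith))
            · linarith
        _ = _ := by ring
  | succ l ih =>
    obtain ⟨C, hC0, hC⟩ := ih k f
    obtain ⟨D, hD0, hD⟩ := ih k (SchwartzMap.derivCLM ℂ ℂ f)
    refine ⟨2 * Real.pi * C + D, by positivity, fun x y => ?_⟩
    have hx := abs_nonneg x
    have hy := abs_nonneg y
    refine (seminorm_deriv_le k l _).trans ?_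
    rw [deriv_shiftMod]
    refine (map_add_le_add _ _ _).trans ?_
    rw [map_smul_eq_mul]
    have h1 := hC x y
    have h2 := hD x y
    simp only [norm_mul, Complex.norm_I, Complex.norm_ofNat, Complex.norm_real,
      Real.norm_eq_abs, abs_of_pos Real.pi_pos, mul_one]
    calc _ ≤ D * (1 + |x| + |y|) ^ (k + l) * (1 + |x| + |y|) +
          2 * Real.pi * (1 + |x| + |y|) * (C * (1 + |x| + |y|) ^ (k + l)) := by
          gcongr
          · refine h2.trans (le_mul_of_one_le_right (by positivity) (by linarith))
          · linarith
      _ = _ := by ring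

/-- Series of phase-space translates with rapidly decaying coefficients converge absolutely in
every Schwartz seminorm. -/
theorem summable_seminorm_shiftMod {ι : Type*} [Finite ι] (a c : ℤ × ℤ → ℂ) (ha : RapidDecay a)
    (hc : ∀ p, ‖c p‖ = 1) (x y : ℤ × ℤ → ℝ) (K : ℝ)
    (hxy : ∀ p, 1 + |x p| + |y p| ≤ K * weight p) (ξ : ι → 𝓢(ℝ, ℂ)) (i : ℤ × ℤ → ι) (k l : ℕ) :
    Summable fun p => SchwartzMap.seminorm ℂ k l
      (a p • c p • shiftMod (x p) (y p) (ξ (i p))) := by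
  choose C hC0 hC using fun j => seminorm_shiftMod_le l k (ξ j)
  obtain ⟨B, hB⟩ := (Set.finite_range C).bddAbove
  have hB' : ∀ j, C j ≤ B := fun j => hB (Set.mem_range_self j)
  have hB0 : 0 ≤ B := (hC0 (i 0)).trans (hB' _)
  refine Summable.of_nonneg_of_le (fun p => apply_nonneg _ _) (fun p => ?_)
    ((ha.summable (k + l)).mul_left (B * K ^ (k + l)))
  have hx := abs_nonneg (x p)
  have hy := abs_nonneg (y p)
  rw [map_smul_eq_mul, map_smul_eq_mul, hc, one_mul]
  calc _ ≤ ‖a p‖ * (B * (K * weight p) ^ (k + l)) := by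
        gcongr
        refine (hC (i p) (x p) (y p)).trans ?_
        gcongr
        · exact hB' _
        · exact hxy p
    _ = _ := by rw [mul_pow]; ring

/-- The `L²` pairing, antilinear in the first argument. -/
def pairing (f g : 𝓢(ℝ, ℂ)) : ℂ := ∫ s, conj (f s) * g s

/-- Complex conjugation of Schwartz functions. -/
def conjS (f : 𝓢(ℝ, ℂ)) : 𝓢(ℝ, ℂ) :=
  SchwartzMap.postcompCLM (𝕜 := ℝ) (Complex.conjCLE : ℂ →L[ℝ] ℂ) f

theorem conjS_apply (f : 𝓢(ℝ, ℂ)) (s : ℝ) : conjS f s = conj (f s) := rfl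

theorem integrable_pairing (f g : 𝓢(ℝ, ℂ)) :
    MeasureTheory.Integrable fun s => conj (f s) * g s := by
  have := (SchwartzMap.pairing (ContinuousLinearMap.mul ℝ ℂ) (conjS f) g).integrable
    (μ := MeasureTheory.volume)
  exact this

theorem pairing_add_left (f f' g : 𝓢(ℝ, ℂ)) :
    pairing (f + f') g = pairing f g + pairing f' g := by
  simp only [pairing, add_apply, map_add, add_mul]
  exact MeasureTheory.integral_add (integrable_pairing _ _) (integrable_pairing _ _)

theorem pairing_smul_left (c : ℂ) (f g : 𝓢(ℝ, ℂ)) :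
    pairing (c • f) g = conj c * pairing f g := by
  simp only [pairing, smul_apply, smul_eq_mul, map_mul, mul_assoc]
  exact MeasureTheory.integral_const_mul _ _

theorem pairing_mulX (f g : 𝓢(ℝ, ℂ)) : pairing (mulX f) g = pairing f (mulX g) := by
  simp only [pairing, mulX_apply, map_mul, Complex.conj_ofReal]
  congr 1; funext s; ring

theorem pairing_deriv (f g : 𝓢(ℝ, ℂ)) :
    pairing (SchwartzMap.derivCLM ℂ ℂ f) g = -pairing f (SchwartzMap.derivCLM ℂ ℂ g) := by
  have h := SchwartzMap.integral_mul_deriv_eq_neg_deriv_mul (conjS f) g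
  have hd : ∀ s, deriv (conjS f) s = conj (deriv f s) := fun s =>
    ((f.hasDerivAt s).star).deriv
  simp only [hd, conjS_apply] at h
  simp only [pairing, SchwartzMap.derivCLM_apply]
  rw [h, neg_neg]

theorem norm_pairing_shiftMod_le (f g : 𝓢(ℝ, ℂ)) (x y : ℝ) :
    ‖pairing (shiftMod x y f) g‖ ≤ SchwartzMap.seminorm ℂ 0 0 f * ∫ s, ‖g s‖ := by
  unfold pairing
  refine (MeasureTheory.norm_integral_le_integral_norm _).trans ?_
  rw [← MeasureTheory.integral_const_mul]
  refine MeasureTheory.integral_mono (integrable_pairing _ _).norm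
    ((g.integrable (μ := MeasureTheory.volume)).norm.const_mul _) fun s => ?_
  simp only [norm_mul, RCLike.norm_conj, shiftMod_apply, norm_e, one_mul]
  gcongr
  exact SchwartzMap.norm_le_seminorm ℂ f _

/-! ### The Heisenberg module -/

/-- The space `E_{r,q} = 𝓢(ℝ × ℤ_q)`, where `ξ k s` is the value at `(s, k)`. -/
abbrev HeisenbergModule (q : ℕ) : Type := ZMod q → 𝓢(ℝ, ℂ)

variable {q : ℕ}

/-- `ε = r / q - α`. -/
def eps (α : ℝ) (r : ℤ) (q : ℕ) : ℝ := r / q - α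

/-- `ξ Z₁ᵐ Z₂ⁿ`, for the operators `(ξ Z₁)(s, k) = ξ(s - ε, k - r)` and
`(ξ Z₂)(s, k) = e(s - k / q) ξ(s, k)`; see `rightMono_apply`. -/
def rightMono (α : ℝ) (r : ℤ) (p : ℤ × ℤ) (ξ : HeisenbergModule q) : HeisenbergModule q :=
  fun k => e (-(p.2 * k.val / q)) • shiftMod (p.1 * eps α r q) p.2 (ξ (k - (p.1 * r : ℤ)))

theorem rightMono_apply (α : ℝ) (r m n : ℤ) (ξ : HeisenbergModule q) (k : ZMod q) (s : ℝ) :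
    rightMono α r (m, n) ξ k s =
      e (n * (s - k.val / q)) * ξ (k - (m * r : ℤ)) (s - m * eps α r q) := by
  simp only [rightMono, smul_apply, smul_eq_mul, shiftMod_apply]
  rw [← mul_assoc, ← e_add]
  congr 2
  ring

theorem one_add_le (K L : ℝ) (hK : 0 ≤ K) (hL : 0 ≤ L) (p : ℤ × ℤ) :
    1 + K * |(p.1 : ℝ)| + L * |(p.2 : ℝ)| ≤ (1 + K + L) * weight p := by
  unfold weight
  nlinarith [abs_nonneg (p.1 : ℝ), abs_nonneg (p.2 : ℝ),
    mul_nonneg hK (abs_nonneg (p.2 : ℝ)), mul_nonneg hL (abs_nonneg (p.1 : ℝ))]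

/-- The right action of `A_α`: `ξ a = ∑ a (m, n) ξ Z₁ᵐ Z₂ⁿ`. -/
def rightAct {α : ℝ} (r : ℤ) [NeZero q] (ξ : HeisenbergModule q) (a : NCTorus α) :
    HeisenbergModule q :=
  fun k => schwartzSum (fun p => a.coeff p • rightMono α r p ξ k)
    (summable_seminorm_shiftMod a.coeff _ a.rapid (fun p => norm_e _) _ _
      (1 + |eps α r q| + 1)
      (fun p => by
        have := one_add_le |eps α r q| 1 (abs_nonneg _) zero_le_one p
        rw [abs_mul]; linarith) ξ (fun p => k - (p.1 * r : ℤ)))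

/-- `θ = (a α + b) / (-q α + r)`. -/
def moritaParam (α : ℝ) (a b r : ℤ) (q : ℕ) : ℝ := (a * α + b) / (-q * α + r)

/-- `U₁ᵘ U₂ᵛ ξ`, for the operators `(U₁ ξ)(s, k) = ξ(s - 1 / q, k - 1)` and
`(U₂ ξ)(s, k) = e((s / ε - a k) / q) ξ(s, k)`; see `leftMono_apply`. -/
def leftMono (α : ℝ) (a r : ℤ) (p : ℤ × ℤ) (ξ : HeisenbergModule q) : HeisenbergModule q :=
  fun k => e (-(p.2 * ((p.1 / q) / eps α r q + a * (k - (p.1 : ZMod q)).val) / q)) •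
    shiftMod (p.1 / q) (p.2 / (eps α r q * q)) (ξ (k - (p.1 : ZMod q)))

theorem leftMono_apply (α : ℝ) (a r u v : ℤ) (ξ : HeisenbergModule q) (k : ZMod q) (s : ℝ) :
    leftMono α a r (u, v) ξ k s =
      e (v * (((s - u / q) / eps α r q - a * (k - (u : ZMod q)).val) / q)) *
        ξ (k - (u : ZMod q)) (s - u / q) := by
  simp only [leftMono, smul_apply, smul_eq_mul, shiftMod_apply]
  rw [← mul_assoc, ← e_add]
  congr 2
  ring

/-- The left action of `A_θ`, `θ = (a α + b) / (-q α + r)`, through which `A_θ` is identified with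
the endomorphisms of the right `A_α`-module `E_{r,q}`: `x ξ = ∑ x (u, v) U₁ᵘ U₂ᵛ ξ`. -/
def leftAct {α : ℝ} {a b r : ℤ} [NeZero q] (x : NCTorus (moritaParam α a b r q))
    (ξ : HeisenbergModule q) : HeisenbergModule q :=
  fun k => schwartzSum (fun p => x.coeff p • leftMono α a r p ξ k)
    (summable_seminorm_shiftMod x.coeff _ x.rapid (fun p => norm_e _) _ _
      (1 + |(q : ℝ)⁻¹| + |(eps α r q * q)⁻¹|)
      (fun p => by
        have := one_add_le |(q : ℝ)⁻¹| |(eps α r q * q)⁻¹| (abs_nonneg _) (abs_nonneg _) p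
        rw [div_eq_mul_inv, div_eq_mul_inv, abs_mul, abs_mul]; linarith) ξ
      (fun p => k - (p.1 : ZMod q)))

/-- The coefficients of the hermitian structure: the coefficient of `Z₁ᵐ Z₂ⁿ` is
`∑ₖ ∫ conj(ξ(s - m ε, k - m r)) η(s, k) e(-n (s - k / q)) ds`,
the `L²` inner product of `ξ Z₁ᵐ Z₂ⁿ` and `η`. -/
def hermCoeff (α : ℝ) (r : ℤ) [NeZero q] (ξ η : HeisenbergModule q) (p : ℤ × ℤ) : ℂ :=
  ∑ k, pairing (rightMono α r p ξ k) (η k)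

theorem hermCoeff_eq (α : ℝ) (r m n : ℤ) [NeZero q] (ξ η : HeisenbergModule q) :
    hermCoeff α r ξ η (m, n) = ∑ k : ZMod q, ∫ s : ℝ,
      conj (ξ (k - (m * r : ℤ)) (s - m * eps α r q)) * η k s * e (-(n * (s - k.val / q))) := by
  have he : ∀ x : ℝ, conj (e x) = e (-x) := fun x => by
    simp only [e, ← Complex.exp_conj]
    congr 1
    simp only [map_mul, map_ofNat, Complex.conj_ofReal, Complex.conj_I, Complex.ofReal_neg]
    ring
  simp only [hermCoeff, pairing, rightMono_apply, map_mul, he]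
  refine Finset.sum_congr rfl fun k _ => ?_
  congr 1; funext s; ring

theorem hermCoeff_mulX (α : ℝ) (r : ℤ) [NeZero q] (ξ η : HeisenbergModule q) (p : ℤ × ℤ) :
    hermCoeff α r ξ (fun k => mulX (η k)) p = hermCoeff α r (fun k => mulX (ξ k)) η p +
      (p.1 * eps α r q : ℝ) * hermCoeff α r ξ η p := by
  simp only [hermCoeff, Finset.mul_sum, ← Finset.sum_add_distrib]
  refine Finset.sum_congr rfl fun k _ => ?_
  simp only [rightMono, pairing_smul_left, ← pairing_mulX (shiftMod _ _ _), mulX_shiftMod,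
    pairing_add_left, Complex.conj_ofReal]
  ring

theorem hermCoeff_deriv (α : ℝ) (r : ℤ) [NeZero q] (ξ η : HeisenbergModule q) (p : ℤ × ℤ) :
    -hermCoeff α r ξ (fun k => SchwartzMap.derivCLM ℂ ℂ (η k)) p =
      hermCoeff α r (fun k => SchwartzMap.derivCLM ℂ ℂ (ξ k)) η p +
        conj (2 * Real.pi * Complex.I * p.2) * hermCoeff α r ξ η p := by
  simp only [hermCoeff, Finset.mul_sum, ← Finset.sum_add_distrib, ← Finset.sum_neg_distrib]
  refine Finset.sum_congr rfl fun k _ => ?_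
  simp only [rightMono, pairing_smul_left]
  rw [← mul_neg, ← pairing_deriv, deriv_shiftMod, pairing_add_left, pairing_smul_left]
  push_cast
  ring

theorem norm_hermCoeff_le (α : ℝ) (r : ℤ) [NeZero q] (ξ η : HeisenbergModule q) :
    ∃ C : ℝ, ∀ p, ‖hermCoeff α r ξ η p‖ ≤ C := by
  refine ⟨∑ k : ZMod q, ∑ j : ZMod q, SchwartzMap.seminorm ℂ 0 0 (ξ j) * ∫ s, ‖η k s‖,
    fun p => (norm_sum_le _ _).trans (Finset.sum_le_sum fun k _ => ?_)⟩
  rw [rightMono, pairing_smul_left, norm_mul, RCLike.norm_conj, norm_e, one_mul]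
  refine (norm_pairing_shiftMod_le _ _ _ _).trans ?_
  exact Finset.single_le_sum (f := fun j => SchwartzMap.seminorm ℂ 0 0 (ξ j) * ∫ s, ‖η k s‖)
    (fun j _ => mul_nonneg (apply_nonneg _ _)
      (MeasureTheory.integral_nonneg fun s => norm_nonneg _)) (Finset.mem_univ _)

theorem rapidDecay_hermCoeff {α : ℝ} {r : ℤ} [NeZero q] (hε : eps α r q ≠ 0)
    (ξ η : HeisenbergModule q) : RapidDecay (hermCoeff α r ξ η) := by
  intro N
  induction N generalizing ξ η with
  | zero => simpa using norm_hermCoeff_le α r ξ η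
  | succ N ih =>
    obtain ⟨C0, h0⟩ := ih ξ η
    obtain ⟨C1, h1⟩ := ih ξ (fun k => mulX (η k))
    obtain ⟨C2, h2⟩ := ih (fun k => mulX (ξ k)) η
    obtain ⟨C3, h3⟩ := ih ξ (fun k => SchwartzMap.derivCLM ℂ ℂ (η k))
    obtain ⟨C4, h4⟩ := ih (fun k => SchwartzMap.derivCLM ℂ ℂ (ξ k)) η
    refine ⟨C0 + |eps α r q|⁻¹ * (C1 + C2) + (2 * Real.pi)⁻¹ * (C3 + C4), fun p => ?_⟩
    have hw := pow_pos (weight_pos p) N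
    have hε' : 0 < |eps α r q| := abs_pos.mpr hε
    have e1 : |(p.1 : ℝ)| * ‖hermCoeff α r ξ η p‖ ≤ |eps α r q|⁻¹ *
        (‖hermCoeff α r ξ (fun k => mulX (η k)) p‖ +
          ‖hermCoeff α r (fun k => mulX (ξ k)) η p‖) := by
      rw [← div_eq_inv_mul, le_div_iff₀ hε']
      have := norm_sub_le (hermCoeff α r ξ (fun k => mulX (η k)) p)
        (hermCoeff α r (fun k => mulX (ξ k)) η p)
      rw [hermCoeff_mulX, add_sub_cancel_left, norm_mul, Complex.norm_real, Real.norm_eq_abs,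
        abs_mul] at this
      rw [hermCoeff_mulX]
      linarith
    have e2 : |(p.2 : ℝ)| * ‖hermCoeff α r ξ η p‖ ≤ (2 * Real.pi)⁻¹ *
        (‖hermCoeff α r ξ (fun k => SchwartzMap.derivCLM ℂ ℂ (η k)) p‖ +
          ‖hermCoeff α r (fun k => SchwartzMap.derivCLM ℂ ℂ (ξ k)) η p‖) := by
      rw [← div_eq_inv_mul, le_div_iff₀ (by positivity)]
      have := norm_sub_le (-hermCoeff α r ξ (fun k => SchwartzMap.derivCLM ℂ ℂ (η k)) p)
        (hermCoeff α r (fun k => SchwartzMap.derivCLM ℂ ℂ (ξ k)) η p)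
      rw [norm_neg] at this
      rw [hermCoeff_deriv, add_sub_cancel_left, norm_mul, RCLike.norm_conj] at this
      simp only [norm_mul, Complex.norm_I, Complex.norm_ofNat, Complex.norm_real,
        Real.norm_eq_abs, abs_of_pos Real.pi_pos, mul_one, Complex.norm_intCast] at this
      linarith
    calc weight p ^ (N + 1) * ‖hermCoeff α r ξ η p‖
        = weight p ^ N * (‖hermCoeff α r ξ η p‖ + |(p.1 : ℝ)| * ‖hermCoeff α r ξ η p‖ +
            |(p.2 : ℝ)| * ‖hermCoeff α r ξ η p‖) := by
          rw [pow_succ]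
          nth_rewrite 2 [weight]
          ring
      _ ≤ weight p ^ N * (‖hermCoeff α r ξ η p‖ + |eps α r q|⁻¹ *
            (‖hermCoeff α r ξ (fun k => mulX (η k)) p‖ +
              ‖hermCoeff α r (fun k => mulX (ξ k)) η p‖) + (2 * Real.pi)⁻¹ *
            (‖hermCoeff α r ξ (fun k => SchwartzMap.derivCLM ℂ ℂ (η k)) p‖ +
              ‖hermCoeff α r (fun k => SchwartzMap.derivCLM ℂ ℂ (ξ k)) η p‖)) := by
          gcongr
      _ = weight p ^ N * ‖hermCoeff α r ξ η p‖ + |eps α r q|⁻¹ *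
            (weight p ^ N * ‖hermCoeff α r ξ (fun k => mulX (η k)) p‖ +
              weight p ^ N * ‖hermCoeff α r (fun k => mulX (ξ k)) η p‖) + (2 * Real.pi)⁻¹ *
            (weight p ^ N * ‖hermCoeff α r ξ (fun k => SchwartzMap.derivCLM ℂ ℂ (η k)) p‖ +
              weight p ^ N *
                ‖hermCoeff α r (fun k => SchwartzMap.derivCLM ℂ ℂ (ξ k)) η p‖) := by ring
      _ ≤ _ := by
          have := h0 p
          have := h1 p
          have := h2 p
          have := h3 p
          have := h4 p
          gcongr

/-- The `A_α`-valued hermitian structure `⟨ξ, η⟩_α`, antilinear in the first argument. -/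
def herm {α : ℝ} {r : ℤ} [NeZero q] (hε : eps α r q ≠ 0) (ξ η : HeisenbergModule q) :
    NCTorus α :=
  NCTorus.mk (hermCoeff α r ξ η) (rapidDecay_hermCoeff hε ξ η)

/-- The covariant derivative `(∇₁ ξ)(s, k) = (2πi / ε) s ξ(s, k)`. -/
def nabla₁ (α : ℝ) (r : ℤ) (ξ : HeisenbergModule q) : HeisenbergModule q :=
  fun k => (2 * Real.pi * Complex.I / eps α r q : ℂ) • mulX (ξ k)

/-- The covariant derivative `(∇₂ ξ)(s, k) = (dξ / ds)(s, k)`. -/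
def nabla₂ (ξ : HeisenbergModule q) : HeisenbergModule q :=
  fun k => SchwartzMap.derivCLM ℂ ℂ (ξ k)

/-- The antiholomorphic connection `∇̄ = (τ - τ̄)⁻¹ (τ ∇₁ - ∇₂)`, the lift of `∂̄_(τ)`. -/
def nablaBar (τ : ℂ) (α : ℝ) (r : ℤ) (ξ : HeisenbergModule q) : HeisenbergModule q :=
  (τ - conj τ)⁻¹ • (τ • nabla₁ α r ξ - nabla₂ ξ)

/-- The endomorphism `|ψ⟩ h ⟨ψ|` of `E_{r,q}`, sending `η` to `ψ (h ⟨ψ, η⟩_α)`. -/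
def ketBra {α : ℝ} {r : ℤ} [NeZero q] (hε : eps α r q ≠ 0) (ψ : HeisenbergModule q)
    (h : NCTorus α) (η : HeisenbergModule q) : HeisenbergModule q :=
  rightAct r ψ (h * herm hε ψ η)

end NCSigma

end

noncomputable section

namespace NCSigma

section

/-! ### Series of Schwartz functions -/

/-! The Heisenberg module is a Morita equivalence bimodule: besides `herm` it carries an
`A_θ`-valued hermitian structure, `leftHerm`, written `{ξ, η}` below, and the two are tied by `{ξ,
η} ζ = ξ ⟨η, ζ⟩_α` (`leftAct_leftHerm`). Hence `|ψ⟩ h⁻¹ ⟨ψ|`, with `h = ⟨ψ, ψ⟩_α`, is the action of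
the explicit element `p = {ψ h⁻¹, ψ}` of `A_θ`.

The identity is Poisson summation used twice. At a point `(s, k)` the powers of `Z₂` on one side and
of `U₂` on the other form Fourier series. Summing each one replaces it by a sum over translates, by
the lattice of `U₁` and by the lattice of `Z₁` respectively. Both sides become the same absolutely
convergent double sum, taken in opposite orders.

The left action is faithful (`eq_zero_of_leftAct_eq_zero`): a narrow bump function isolates one
power of `U₁`, and what remains is a vanishing Fourier series in the powers of `U₂`. So `p` is
unique, and identities in `A_θ` may be checked on the module. Since `⟨ψ, ψ c⟩_α = h c`, `p` fixes
every `ψ c`, while its image lies in `ψ A_α`; this gives `p² = p`. Self-adjointness comes from `{ξ,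
η}* = {η, ξ}` and `h* = h`.

For self-duality, the connection obeys Leibniz rules for both actions; on the left, `∇̄(x ξ) = x ∇̄ξ
+ (q ε)⁻¹ ∂̄(x) ξ`. If `∂̄(p) p = 0`, applying this to `p ψ = ψ` gives `∇̄ψ = p ∇̄ψ`, which lies in
`ψ A_α`. Conversely, if `∇̄ψ = ψ λ`, then `∇̄` preserves `ψ A_α`, on which `p` is the identity, so
`∂̄(p)` kills `ψ A_α`, the image of `p`. The second form of the equation is the adjoint of the
first. -/

theorem seminorm_schwartzSum_le {ι : Type*} (F : ι → 𝓢(ℝ, ℂ))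
    (hF : ∀ k l : ℕ, Summable fun i => SchwartzMap.seminorm ℂ k l (F i)) (k l : ℕ) :
    SchwartzMap.seminorm ℂ k l (schwartzSum F hF) ≤
      ∑' i, SchwartzMap.seminorm ℂ k l (F i) := by
  refine SchwartzMap.seminorm_le_bound ℂ k l _ (tsum_nonneg fun i => apply_nonneg _ _) fun x => ?_
  change ‖x‖ ^ k * ‖iteratedFDeriv ℝ l (fun s => ∑' i, F i s) x‖ ≤ _
  rw [iteratedFDeriv_tsum_apply (f := fun i => ⇑(F i)) (N := ⊤)
    (v := fun j i => SchwartzMap.seminorm ℂ 0 j (F i))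
    (fun i => (F i).smooth') (fun j _ => hF 0 j)
    (fun j i x _ => SchwartzMap.norm_iteratedFDeriv_le_seminorm ℂ (F i) j x) le_top]
  have hs : Summable fun i => ‖iteratedFDeriv ℝ l (F i) x‖ :=
    Summable.of_nonneg_of_le (fun i => norm_nonneg _)
      (fun i => SchwartzMap.norm_iteratedFDeriv_le_seminorm ℂ (F i) l x) (hF 0 l)
  calc ‖x‖ ^ k * ‖∑' i, iteratedFDeriv ℝ l (F i) x‖
      ≤ ‖x‖ ^ k * ∑' i, ‖iteratedFDeriv ℝ l (F i) x‖ := by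
        gcongr; exact norm_tsum_le_tsum_norm hs
    _ = ∑' i, ‖x‖ ^ k * ‖iteratedFDeriv ℝ l (F i) x‖ := by rw [tsum_mul_left]
    _ ≤ _ := (hs.mul_left _).tsum_le_tsum
        (fun i => SchwartzMap.le_seminorm ℂ k l (F i) x) (hF k l)

theorem summable_apply {ι : Type*} (F : ι → 𝓢(ℝ, ℂ))
    (hF : ∀ k l : ℕ, Summable fun i => SchwartzMap.seminorm ℂ k l (F i)) (s : ℝ) :
    Summable fun i => F i s :=
  Summable.of_norm_bounded (hF 0 0) fun i => SchwartzMap.norm_le_seminorm ℂ (F i) s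

/-- A series that converges absolutely in every seminorm converges in the Schwartz space. -/
theorem hasSum_schwartzSum {ι : Type*} (F : ι → 𝓢(ℝ, ℂ))
    (hF : ∀ k l : ℕ, Summable fun i => SchwartzMap.seminorm ℂ k l (F i)) :
    HasSum F (schwartzSum F hF) := by
  refine ((schwartz_withSeminorms ℂ ℝ ℂ).tendsto_nhds _ _).2 fun m δ hδ => ?_
  have ht := tendsto_order.1 (tendsto_tsum_compl_atTop_zero
    fun i => SchwartzMap.seminorm ℂ m.1 m.2 (F i)) |>.2 δ hδ
  filter_upwards [ht] with S hS
  refine lt_of_le_of_lt ?_ hS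
  have hF' : ∀ k l : ℕ, Summable fun i : {i // i ∉ S} => SchwartzMap.seminorm ℂ k l (F i) :=
    fun k l => (hF k l).subtype _
  -- The error of a partial sum is minus the series over the complement, so each of its seminorms is
  -- at most the tail of a convergent series.
  have h1 : ∑ i ∈ S, F i - schwartzSum F hF =
      -schwartzSum (fun i : {i // i ∉ S} => F i) hF' := by
    ext s
    have h2 := (summable_apply F hF s).sum_add_tsum_subtype_compl S
    simp only [sub_apply, neg_apply, schwartzSum_apply, sum_apply]
    rw [← h2]
    ring
  change SchwartzMap.seminorm ℂ m.1 m.2 (∑ i ∈ S, F i - schwartzSum F hF) ≤ _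
  rw [h1, map_neg_eq_map]
  exact seminorm_schwartzSum_le _ hF' m.1 m.2

/-- The `L²` pairing as a continuous linear functional of its second argument. -/
def pairingCLM (f : 𝓢(ℝ, ℂ)) : 𝓢(ℝ, ℂ) →L[ℂ] ℂ :=
  (SchwartzMap.integralCLM ℂ MeasureTheory.volume).comp
    (SchwartzMap.pairing (ContinuousLinearMap.mul ℂ ℂ) (conjS f))

theorem pairingCLM_apply (f g : 𝓢(ℝ, ℂ)) : pairingCLM f g = pairing f g := rfl

/-! ### Symmetry of the pairing, phases, and unitarity of phase-space translations. -/

theorem conj_pairing (f g : 𝓢(ℝ, ℂ)) : conj (pairing f g) = pairing g f := by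
  rw [pairing, pairing, ← integral_conj]
  congr 1; funext s
  simp [mul_comm]

theorem conj_e (x : ℝ) : conj (e x) = e (-x) := by
  simp only [e, ← Complex.exp_conj]
  congr 1
  simp only [map_mul, map_ofNat, Complex.conj_ofReal, Complex.conj_I, Complex.ofReal_neg]
  ring

theorem e_intCast (n : ℤ) : e n = 1 := by
  rw [e]
  have := Complex.exp_int_mul_two_pi_mul_I n
  rw [← this]; congr 1; push_cast; ring

theorem e_mul_e_neg (x : ℝ) : e x * e (-x) = 1 := by rw [← e_add]; simp [e_zero]

theorem e_eq_of_sub_eq_intCast {x y : ℝ} (n : ℤ) (h : x - y = n) : e x = e y := by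
  rw [show x = y + n by linarith, e_add, e_intCast, mul_one]

theorem pairing_shiftMod (x y : ℝ) (f g : 𝓢(ℝ, ℂ)) :
    pairing (shiftMod x y f) (shiftMod x y g) = pairing f g := by
  simp only [pairing, shiftMod_apply, map_mul]
  rw [← MeasureTheory.integral_sub_right_eq_self (fun s => conj (f s) * g s) x]
  congr 1; funext s
  rw [conj_e]
  linear_combination (conj (f (s - x)) * g (s - x)) * e_mul_e_neg (y * s)

/-- Dilation: `(dilate c f)(s) = f(c s)`. -/
def dilate (c : ℝ) (hc : c ≠ 0) (f : 𝓢(ℝ, ℂ)) : 𝓢(ℝ, ℂ) :=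
  SchwartzMap.compCLMOfContinuousLinearEquiv ℂ
    (ContinuousLinearEquiv.unitsEquivAut ℝ (Units.mk0 c hc)) f

theorem dilate_apply (c : ℝ) (hc : c ≠ 0) (f : 𝓢(ℝ, ℂ)) (s : ℝ) :
    dilate c hc f s = f (c * s) := by
  simp [dilate, mul_comm]

/-! ### Sums over arithmetic progressions and Poisson summation. -/

theorem summable_norm_intCast (f : 𝓢(ℝ, ℂ)) : Summable fun n : ℤ => ‖f n‖ := by
  have h := (f.isBigO_cocompact_rpow (-2)).comp_tendsto Int.tendsto_coe_cofinite
  refine summable_of_isBigO (Real.summable_abs_int_rpow one_lt_two) ?_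
  exact h.norm_left

theorem summable_norm_progression (f : 𝓢(ℝ, ℂ)) (x : ℝ) {c : ℝ} (hc : c ≠ 0) :
    Summable fun n : ℤ => ‖f (x + n * c)‖ := by
  refine (summable_norm_intCast (dilate c hc (f.compSubConstCLM ℂ (-x)))).congr fun n => ?_
  rw [dilate_apply, SchwartzMap.compSubConstCLM_apply]
  congr 2; ring

variable {q : ℕ}

theorem summable_norm_progression_zmod [NeZero q] (F : ZMod q → 𝓢(ℝ, ℂ)) (i : ℤ → ZMod q)
    (x : ℝ) {c : ℝ} (hc : c ≠ 0) : Summable fun n : ℤ => ‖F (i n) (x + n * c)‖ :=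
  Summable.of_nonneg_of_le (fun _ => norm_nonneg _)
    (fun n => Finset.single_le_sum (f := fun j => ‖F j (x + n * c)‖)
      (fun _ _ => norm_nonneg _) (Finset.mem_univ (i n)))
    (summable_sum fun j _ => summable_norm_progression (F j) x hc)

theorem exists_val_eq [NeZero q] (k : ZMod q) (n : ℤ) (h : (n : ZMod q) = k) :
    ∃ l : ℤ, (k.val : ℤ) = n + q * l := by
  have : ((k.val - n : ℤ) : ZMod q) = 0 := by simp [h]
  obtain ⟨l, hl⟩ := (ZMod.intCast_zmod_eq_zero_iff_dvd _ q).1 this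
  exact ⟨l, by linarith⟩

/-- Used to split a sum over `u ∈ ℤ` according to the residue class `j = k + u`, each class being a
progression of step `q`. -/
theorem bijective_residue [NeZero q] (k : ZMod q) :
    Function.Bijective fun x : ZMod q × ℤ => (x.1.val : ℤ) - k.val + q * x.2 := by
  have hq : (q : ℤ) ≠ 0 := by exact_mod_cast NeZero.ne q
  have key : ∀ x : ZMod q × ℤ, k + (((x.1.val : ℤ) - k.val + q * x.2 : ℤ) : ZMod q) = x.1 := by
    intro x; simp
  constructor
  · intro x y hxy
    have h1 : x.1 = y.1 := by
      rw [← key x, ← key y]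
      congr 2
    refine Prod.ext h1 ?_
    simp only [h1, add_right_inj] at hxy
    exact mul_left_cancel₀ hq hxy
  · intro u
    obtain ⟨l, hl⟩ := exists_val_eq (k + (u : ZMod q)) (k.val + u) (by simp)
    exact ⟨(k + (u : ZMod q), -l), by simp only; rw [hl]; ring⟩

open FourierTransform in
theorem fourier_eq_integral_e (f : 𝓢(ℝ, ℂ)) (n : ℝ) : 𝓕 f n = ∫ t, f t * e (-(n * t)) := by
  rw [SchwartzMap.fourier_coe, Real.fourier_real_eq_integral_exp_smul]
  congr 1; funext t
  rw [smul_eq_mul, mul_comm, e]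
  congr 2; push_cast; ring

open FourierTransform in
/-- Poisson summation on `ℝ × ℤ_q`, for the lattice generated by `(1 / q, 1)`. -/
theorem tsum_heisenberg_eq [NeZero q] (F : ZMod q → 𝓢(ℝ, ℂ)) (k : ZMod q) (s : ℝ) :
    ∑' n : ℤ, (∑ j, ∫ t, F j t * e (-(n * (t - j.val / q)))) * e (n * (s - k.val / q)) =
      ∑' u : ℤ, F (k + u) (s + u / q) := by
  have hq : (q : ℝ) ≠ 0 := by exact_mod_cast NeZero.ne q
  let x : ZMod q → ℝ := fun j => s + (j.val - k.val) / q
  have hf : ∀ (n : ℤ) (y : ℝ), fourier n (y : UnitAddCircle) = e (n * y) := fun n y => by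
    rw [fourier_coe_apply, e]
    congr 1; push_cast; ring
  have h1 : ∀ n : ℤ,
      (∑ j, ∫ t, F j t * e (-(n * (t - j.val / q)))) * e (n * (s - k.val / q)) =
        ∑ j, 𝓕 (F j) n * fourier n (x j : UnitAddCircle) := by
    intro n
    rw [Finset.sum_mul]
    refine Finset.sum_congr rfl fun j _ => ?_
    rw [fourier_eq_integral_e, hf, ← MeasureTheory.integral_mul_const,
      ← MeasureTheory.integral_mul_const]
    congr 1; funext t
    rw [mul_assoc, mul_assoc, ← e_add, ← e_add]
    congr 2; simp only [x]; ring
  have hs : Summable fun u : ℤ => F (k + u) (s + u / q) := by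
    simp_rw [div_eq_mul_inv]
    exact (summable_norm_progression_zmod F (fun u => k + u) s (inv_ne_zero hq)).of_norm
  -- On the residue class `j = k + u` the translates `s + u / q` are `x j + l` with `l ∈ ℤ`, so the
  -- claim reduces to ordinary Poisson summation for each `F j` at `x j`.
  let σ := Equiv.ofBijective _ (bijective_residue k)
  have hσ : ∀ y : ZMod q × ℤ, F (k + (σ y : ℤ)) (s + (σ y : ℤ) / q) = F y.1 (x y.1 + y.2) := by
    intro y
    have h2 : s + (((y.1.val : ℤ) - k.val + q * y.2 : ℤ) : ℝ) / q =
        s + (y.1.val - k.val) / q + y.2 := by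
      push_cast; field_simp; ring
    simp only [σ, Equiv.ofBijective_apply, x, h2]
    congr 2
    simp
  have hs' : Summable fun y : ZMod q × ℤ => F y.1 (x y.1 + y.2) :=
    (σ.summable_iff.2 hs).congr hσ
  simp_rw [h1]
  rw [Summable.tsum_finsetSum, ← σ.tsum_eq]
  · simp_rw [hσ]
    rw [hs'.tsum_prod, tsum_fintype]
    exact Finset.sum_congr rfl fun j _ => (SchwartzMap.tsum_eq_tsum_fourier (F j) (x j)).symm
  · intro j _
    refine Summable.of_norm ((summable_norm_intCast (𝓕 (F j))).congr fun n => ?_)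
    rw [norm_mul, hf, norm_e, mul_one]

/-- Poisson summation on `ℝ × ℤ_q`, for the lattice generated by `(c / q, r)`. -/
theorem tsum_heisenberg_eq_of_dilate [NeZero q] {a b r : ℤ} (hab : a * r + b * q = 1) {c : ℝ}
    (hc : c ≠ 0) (F : ZMod q → 𝓢(ℝ, ℂ)) (k : ZMod q) (s : ℝ) :
    ∑' n : ℤ, (|c|⁻¹ * ∑ j, ∫ t, F j t * e (-(n * (t / c - a * j.val / q)))) *
      e (n * (s / c - a * k.val / q)) = ∑' u : ℤ, F (k + (u * r : ℤ)) (s + u * (c / q)) := by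
  have hq : (q : ℝ) ≠ 0 := by exact_mod_cast NeZero.ne q
  have har : (a : ZMod q) * r = 1 := by
    have := congrArg (Int.cast : ℤ → ZMod q) hab
    simpa using this
  -- The representative of `a j` differs from `a * j.val` by a multiple of `q`, which changes the
  -- phase by an integer only.
  have hval : ∀ (n : ℤ) (y : ℝ) (j : ZMod q),
      e (n * (y - (a * j : ZMod q).val / q)) = e (n * (y - a * j.val / q)) := by
    intro n y j
    obtain ⟨l, hl⟩ := exists_val_eq (a * j : ZMod q) (a * j.val) (by simp)
    have hl' : ((a * j : ZMod q).val : ℝ) = a * j.val + q * l := by exact_mod_cast hl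
    refine e_eq_of_sub_eq_intCast (-(n * l)) ?_
    rw [hl']; push_cast; field_simp; ring
  -- Since `a r = 1` in `ℤ_q`, the change of variables `(t, j) ↦ (c t, r j)` carries the lattice
  -- generated by `(1 / q, 1)` to that generated by `(c / q, r)`; the factor `|c|⁻¹` is its
  -- Jacobian.
  have h := tsum_heisenberg_eq (fun j => dilate c hc (F ((r : ZMod q) * j))) ((a : ZMod q) * k) (s / c)
  simp only [dilate_apply] at h
  refine Eq.trans (tsum_congr fun n => ?_) (h.trans (tsum_congr fun u => ?_))
  · rw [hval]
    congr 1
    rw [Finset.mul_sum]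
    let σ : ZMod q ≃ ZMod q :=
      { toFun := fun j => (a : ZMod q) * j
        invFun := fun j => (r : ZMod q) * j
        left_inv := fun j => by linear_combination j * har
        right_inv := fun j => by linear_combination j * har }
    refine (Finset.sum_congr rfl fun j _ => ?_).trans (Equiv.sum_comp σ fun j =>
      ∫ t, F (r * j) (c * t) * e (-(n * (t - j.val / q))))
    have hj : (r : ZMod q) * (σ j) = j := σ.left_inv j
    rw [hj]
    have hI := MeasureTheory.Measure.integral_comp_mul_left
      (fun t => F j t * e (-(n * (t / c - a * j.val / q)))) c
    rw [abs_inv, Complex.real_smul] at hI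
    rw [← hI]
    congr 1; funext t
    have := hval (-n) t j
    push_cast at this
    simp only [neg_mul] at this
    change _ = _ * e (-(n * (t - (a * j : ZMod q).val / q)))
    rw [this]
    congr 4
    field_simp
  · congr 2
    · push_cast
      linear_combination k * har
    · field_simp

end

section

/-! ### Bounded families indexed by `ℤ²` -/

namespace NCTorus

variable {θ : ℝ}

theorem summable_coeff_mul (a : NCTorus θ) {f : ℤ × ℤ → ℂ} {C : ℝ} (hf : ∀ p, ‖f p‖ ≤ C) :
    Summable fun p => a.coeff p * f p :=
  Summable.of_norm_bounded (a.rapid.summable_norm.mul_right C) fun p => by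
    rw [norm_mul]
    exact mul_le_mul_of_nonneg_left (hf p) (norm_nonneg _)

theorem summable_coeff_mul_coeff (a b : NCTorus θ) {f : ℤ × ℤ → ℂ} {C : ℝ}
    (hf : ∀ p, ‖f p‖ ≤ C) : Summable fun x : (ℤ × ℤ) × (ℤ × ℤ) =>
      a.coeff x.1 * (b.coeff x.2 * (e (θ * (x.1.2 * x.2.1)) * f (x.1 + x.2))) := by
  refine Summable.of_norm_bounded ((a.rapid.summable_norm.mul_of_nonneg b.rapid.summable_norm
    (fun _ => norm_nonneg _) (fun _ => norm_nonneg _)).mul_right C) fun x => ?_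
  simp only [norm_mul, norm_e, one_mul]
  rw [← mul_assoc]
  exact mul_le_mul_of_nonneg_left (hf _) (mul_nonneg (norm_nonneg _) (norm_nonneg _))

/-- Evaluation of a product on a bounded family. -/
theorem tsum_coeff_mul (a b : NCTorus θ) {f : ℤ × ℤ → ℂ} {C : ℝ} (hf : ∀ p, ‖f p‖ ≤ C) :
    ∑' w, (a * b).coeff w * f w =
      ∑' x, a.coeff x * ∑' z, b.coeff z * (e (θ * (x.2 * z.1)) * f (x + z)) := by
  have hS := summable_coeff_mul_coeff a b hf
  set G : (ℤ × ℤ) × (ℤ × ℤ) → ℂ := fun x =>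
    a.coeff x.1 * (b.coeff x.2 * (e (θ * (x.1.2 * x.2.1)) * f (x.1 + x.2)))
  let E : (ℤ × ℤ) × (ℤ × ℤ) ≃ (ℤ × ℤ) × (ℤ × ℤ) :=
    { toFun := fun x => (x.2, x.1 - x.2)
      invFun := fun x => (x.1 + x.2, x.1)
      left_inv := fun x => by simp
      right_inv := fun x => by simp }
  have hE := (E.summable_iff).2 hS
  have h1 := hE.tsum_prod
  rw [show ∑' x, (G ∘ E) x = ∑' x, G x from E.tsum_eq G, hS.tsum_prod] at h1
  simp_rw [← tsum_mul_left]
  refine Eq.trans ?_ h1.symm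
  refine tsum_congr fun w => ?_
  rw [coeff_mul, ← tsum_mul_right]
  refine tsum_congr fun x => ?_
  simp only [G, E, Function.comp_apply, Equiv.coe_fn_mk, add_sub_cancel, Prod.fst_sub]
  push_cast
  ring

/-- The order of summation suited to the right action, where the first factor acts first. -/
theorem tsum_coeff_mul' (a b : NCTorus θ) {f : ℤ × ℤ → ℂ} {C : ℝ} (hf : ∀ p, ‖f p‖ ≤ C) :
    ∑' w, (a * b).coeff w * f w =
      ∑' z, b.coeff z * ∑' x, a.coeff x * (e (θ * (x.2 * z.1)) * f (x + z)) := by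
  rw [tsum_coeff_mul a b hf]
  simp_rw [← tsum_mul_left]
  have h := summable_coeff_mul_coeff a b hf
  refine Eq.trans (Summable.tsum_comm (f := fun z x =>
    a.coeff x * (b.coeff z * (e (θ * (x.2 * z.1)) * f (x + z)))) ?_) ?_
  · exact (Equiv.prodComm _ _).summable_iff.2 h
  refine tsum_congr fun z => tsum_congr fun x => ?_
  ring

/-! ### The involution and the derivations. -/

theorem star_partial₁ (a : NCTorus θ) : star (partial₁ a) = partial₁ (star a) :=
  ext fun p => by
    simp only [coeff_star, partial₁, coeff_mk, map_mul, map_ofNat, Complex.conj_ofReal,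
      Complex.conj_I, Prod.fst_neg, Int.cast_neg, map_neg, map_intCast]
    ring

theorem star_partial₂ (a : NCTorus θ) : star (partial₂ a) = partial₂ (star a) :=
  ext fun p => by
    simp only [coeff_star, partial₂, coeff_mk, map_mul, map_ofNat, Complex.conj_ofReal,
      Complex.conj_I, Prod.snd_neg, Int.cast_neg, map_neg, map_intCast]
    ring

/-- The basic derivations commute with the star, and `(τ - τ̄)⁻¹` changes sign under conjugation,
which supplies the sign between the two combinations. -/
theorem star_del (τ : ℂ) (a : NCTorus θ) : star (del τ a) = delBar τ (star a) := by
  have h : conj (τ - conj τ)⁻¹ = -(τ - conj τ)⁻¹ := by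
    rw [map_inv₀, map_sub, Complex.conj_conj, ← inv_neg, neg_sub]
  refine ext fun p => ?_
  have h1 := congrArg (fun x => coeff x p) (star_partial₁ a)
  have h2 := congrArg (fun x => coeff x p) (star_partial₂ a)
  simp only [coeff_star] at h1 h2
  simp only [del, delBar, coeff_smul, coeff_sub, ← h1, ← h2]
  rw [coeff_star, coeff_smul, coeff_add, map_mul, h, map_add]
  have h3 : (-(conj τ • partial₁ a)).coeff (-p) = -(conj τ * (partial₁ a).coeff (-p)) := rfl
  rw [h3, map_neg, map_mul, Complex.conj_conj]
  ring

theorem star_star (a : NCTorus θ) : star (star a) = a := ext fun p => by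
  rw [coeff_star, coeff_star, neg_neg, map_mul, Complex.conj_conj, conj_e, mul_assoc, ← e_add]
  simp [e_zero]

theorem star_zero : star (0 : NCTorus θ) = 0 := ext fun p => by simp [coeff_star]

theorem star_one : star (1 : NCTorus θ) = 1 := ext fun p => by
  rw [coeff_star, coeff_one, coeff_one]
  by_cases h : p = 0 <;> simp [h, e_zero]

theorem star_mul (a b : NCTorus θ) : star (a * b) = star b * star a := ext fun p => by
  rw [coeff_star, coeff_mul, coeff_mul, Complex.conj_tsum, ← tsum_mul_right,
    ← (Equiv.subRight p).tsum_eq]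
  refine tsum_congr fun y => ?_
  have h1 : -p - (y - p) = -y := by abel
  have h2 : -(p - y) = y - p := by abel
  -- After the substitution `x = y - p` the coefficients on the two sides agree, and only this
  -- identity of phases is left.
  have h3 : e (-(θ * ((y.2 - p.2) * (-p.1 - (y.1 - p.1))))) * e (θ * (p.1 * p.2)) =
      e (θ * (y.1 * y.2)) * e (θ * ((p.1 - y.1) * (p.2 - y.2))) *
        e (θ * (y.2 * (p.1 - y.1))) := by
    rw [← e_add, ← e_add, ← e_add]
    congr 1; ring
  simp only [Equiv.subRight_apply, coeff_star, map_mul, conj_e, h1, h2, Prod.fst_neg,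
    Prod.fst_sub, Prod.snd_sub, Int.cast_neg, Int.cast_sub]
  linear_combination (conj (a.coeff (y - p)) * conj (b.coeff (-y))) * h3

end NCTorus

end

section

variable {q : ℕ} {α : ℝ} {a b r : ℤ}

/-! ### The connection on each component -/

/-- The antiholomorphic connection on each component. -/
def nablaBarCLM (τ : ℂ) (α : ℝ) (r : ℤ) (q : ℕ) : 𝓢(ℝ, ℂ) →L[ℂ] 𝓢(ℝ, ℂ) :=
  (τ - conj τ)⁻¹ • (τ • (2 * Real.pi * Complex.I / eps α r q : ℂ) •
    SchwartzMap.smulLeftCLM ℂ (fun s : ℝ => (s : ℂ)) - SchwartzMap.derivCLM ℂ ℂ)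

theorem nablaBarCLM_apply (τ : ℂ) (ξ : HeisenbergModule q) (k : ZMod q) :
    nablaBarCLM τ α r q (ξ k) = nablaBar τ α r ξ k := rfl

theorem nablaBarCLM_shiftMod (τ : ℂ) (x y : ℝ) (f : 𝓢(ℝ, ℂ)) :
    nablaBarCLM τ α r q (shiftMod x y f) = shiftMod x y (nablaBarCLM τ α r q f) +
      ((τ - conj τ)⁻¹ * (τ * (2 * Real.pi * Complex.I * (x / eps α r q : ℝ)) -
        2 * Real.pi * Complex.I * y)) • shiftMod x y f := by
  have h : ∀ g : 𝓢(ℝ, ℂ), nablaBarCLM τ α r q g =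
    (τ - conj τ)⁻¹ • (τ • (2 * Real.pi * Complex.I / eps α r q : ℂ) • mulX g -
      SchwartzMap.derivCLM ℂ ℂ g) := fun _ => rfl
  rw [h, h, mulX_shiftMod, deriv_shiftMod]
  ext s
  simp only [shiftMod_apply, add_apply, sub_apply, smul_apply, smul_eq_mul]
  push_cast
  ring

/-- The scalar is the eigenvalue of `∂̄` on `Z₁ᵐ Z₂ⁿ`: this is the Leibniz rule on monomials. -/
theorem nablaBar_rightMono (hε : eps α r q ≠ 0) (τ : ℂ) (p : ℤ × ℤ)
    (ξ : HeisenbergModule q) (k : ZMod q) :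
    nablaBarCLM τ α r q (rightMono α r p ξ k) = rightMono α r p (nablaBar τ α r ξ) k +
      ((τ - conj τ)⁻¹ * (τ * (2 * Real.pi * Complex.I * p.1) -
        2 * Real.pi * Complex.I * p.2)) • rightMono α r p ξ k := by
  simp only [rightMono, map_smul]
  rw [nablaBarCLM_shiftMod, nablaBarCLM_apply, smul_add, mul_div_cancel_right₀ _ hε]
  simp only [Complex.ofReal_intCast]
  congr 1
  exact smul_comm _ _ _

/-- The steps of `U₁` and `U₂` are `1 / q` in position and `1 / (q ε)` in frequency, so the
eigenvalue of `∂̄` appears divided by `q ε`. -/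
theorem nablaBar_leftMono (τ : ℂ) (p : ℤ × ℤ) (ξ : HeisenbergModule q) (k : ZMod q) :
    nablaBarCLM τ α r q (leftMono α a r p ξ k) = leftMono α a r p (nablaBar τ α r ξ) k +
      ((q * eps α r q : ℂ)⁻¹ * ((τ - conj τ)⁻¹ * (τ * (2 * Real.pi * Complex.I * p.1) -
        2 * Real.pi * Complex.I * p.2))) • leftMono α a r p ξ k := by
  simp only [leftMono, map_smul]
  rw [nablaBarCLM_shiftMod, nablaBarCLM_apply, smul_add, smul_comm]
  congr 2
  push_cast
  rw [mul_inv]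
  ring

variable [NeZero q]

/-! ### The two actions on the Heisenberg module -/

theorem eps_mul_eq (α : ℝ) (r : ℤ) : (-q * α + r : ℝ) = q * eps α r q := by
  have hq : (q : ℝ) ≠ 0 := by exact_mod_cast NeZero.ne q
  rw [eps]; field_simp; ring

/-- In this form `θ` is visibly the phase of moving `U₂` past `U₁`: the translation by `1 / q`
contributes `1 / (q² ε)` and the shift of `k` contributes `-a / q`. -/
theorem moritaParam_eq (hab : a * r + b * q = 1) (hε : eps α r q ≠ 0) :
    moritaParam α a b r q = (1 / (q * eps α r q) - a) / q := by
  have hq : (q : ℝ) ≠ 0 := by exact_mod_cast NeZero.ne q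
  have hab' : (a * r + b * q : ℝ) = 1 := by exact_mod_cast hab
  rw [moritaParam, eps_mul_eq, div_eq_div_iff (mul_ne_zero hq hε) hq, sub_mul,
    one_div_mul_cancel (mul_ne_zero hq hε), eps]
  field_simp
  linarith

theorem exists_val_sub (k : ZMod q) (u : ℤ) :
    ∃ l : ℤ, ((k - (u : ZMod q)).val : ℝ) = k.val - u + q * l := by
  obtain ⟨l, hl⟩ := exists_val_eq (k - (u : ZMod q)) (k.val - u) (by simp)
  exact ⟨l, by exact_mod_cast hl⟩

theorem rightMono_rightMono (x y : ℤ × ℤ) (ξ : HeisenbergModule q) :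
    rightMono α r y (rightMono α r x ξ) =
      e (α * (x.2 * y.1)) • rightMono α r (x + y) ξ := by
  obtain ⟨x1, x2⟩ := x
  obtain ⟨y1, y2⟩ := y
  have hq : (q : ℝ) ≠ 0 := by exact_mod_cast NeZero.ne q
  ext k s
  obtain ⟨l, hl⟩ := exists_val_sub k (y1 * r)
  have hk : k - ((y1 * r : ℤ) : ZMod q) - ((x1 * r : ℤ) : ZMod q) =
      k - (((x1 + y1) * r : ℤ) : ZMod q) := by push_cast; ring
  have hs : s - y1 * eps α r q - x1 * eps α r q = s - ((x1 + y1 : ℤ) : ℝ) * eps α r q := by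
    push_cast; ring
  have h : e (y2 * (s - k.val / q)) *
      e (x2 * (s - y1 * eps α r q - (k - ((y1 * r : ℤ) : ZMod q)).val / q)) =
      e (α * (x2 * y1)) * e ((x2 + y2 : ℤ) * (s - k.val / q)) := by
    rw [← e_add, ← e_add]
    -- The change of representative `l` costs an integer; the rest of the phase is `x₂ y₁ (r / q -
    -- ε) = x₂ y₁ α`.
    refine e_eq_of_sub_eq_intCast (-(x2 * l)) ?_
    rw [hl, eps]; push_cast; field_simp; ring
  simp only [Pi.smul_apply, smul_apply, smul_eq_mul, Prod.mk_add_mk, rightMono_apply, hk, hs]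
  rw [← mul_assoc, h, mul_assoc]

theorem leftMono_leftMono (hab : a * r + b * q = 1) (hε : eps α r q ≠ 0) (x y : ℤ × ℤ)
    (ξ : HeisenbergModule q) :
    leftMono α a r x (leftMono α a r y ξ) =
      e (moritaParam α a b r q * (x.2 * y.1)) • leftMono α a r (x + y) ξ := by
  obtain ⟨x1, x2⟩ := x
  obtain ⟨y1, y2⟩ := y
  have hq : (q : ℝ) ≠ 0 := by exact_mod_cast NeZero.ne q
  ext k s
  obtain ⟨l, hl⟩ := exists_val_sub (k - (x1 : ZMod q)) y1
  have hk : k - (x1 : ZMod q) - (y1 : ZMod q) = k - ((x1 + y1 : ℤ) : ZMod q) := by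
    push_cast; ring
  have hs : s - x1 / q - y1 / q = s - ((x1 + y1 : ℤ) : ℝ) / q := by push_cast; ring
  have h : e (x2 * (((s - x1 / q) / eps α r q - a * (k - (x1 : ZMod q)).val) / q)) *
      e (y2 * (((s - (x1 + y1 : ℤ) / q) / eps α r q -
        a * (k - ((x1 + y1 : ℤ) : ZMod q)).val) / q)) =
      e (moritaParam α a b r q * (x2 * y1)) *
        e ((x2 + y2 : ℤ) * (((s - (x1 + y1 : ℤ) / q) / eps α r q -
          a * (k - ((x1 + y1 : ℤ) : ZMod q)).val) / q)) := by
    rw [← e_add, ← e_add]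
    refine e_eq_of_sub_eq_intCast (x2 * a * l) ?_
    rw [← hk, hl, moritaParam_eq hab hε]; push_cast; field_simp; ring
  simp only [Pi.smul_apply, smul_apply, smul_eq_mul, Prod.mk_add_mk, leftMono_apply, hk, hs]
  rw [← mul_assoc, h, mul_assoc]

theorem rightMono_zero (ξ : HeisenbergModule q) : rightMono α r 0 ξ = ξ := by
  ext k s
  rw [show (0 : ℤ × ℤ) = (0, 0) from rfl, rightMono_apply]
  simp [e_zero]

theorem leftMono_zero (ξ : HeisenbergModule q) : leftMono α a r 0 ξ = ξ := by
  ext k s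
  rw [show (0 : ℤ × ℤ) = (0, 0) from rfl, leftMono_apply]
  simp [e_zero]

theorem norm_apply_le (ξ : HeisenbergModule q) (k : ZMod q) (s : ℝ) :
    ‖ξ k s‖ ≤ ∑ j, SchwartzMap.seminorm ℂ 0 0 (ξ j) :=
  (SchwartzMap.norm_le_seminorm ℂ (ξ k) s).trans
    (Finset.single_le_sum (f := fun j => SchwartzMap.seminorm ℂ 0 0 (ξ j))
      (fun _ _ => apply_nonneg _ _) (Finset.mem_univ k))

theorem norm_rightMono_le (ξ : HeisenbergModule q) (k : ZMod q) (s : ℝ) (p : ℤ × ℤ) :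
    ‖rightMono α r p ξ k s‖ ≤ ∑ j, SchwartzMap.seminorm ℂ 0 0 (ξ j) := by
  rw [show p = (p.1, p.2) from rfl, rightMono_apply, norm_mul, norm_e, one_mul]
  exact norm_apply_le ξ _ _

theorem norm_leftMono_le (ξ : HeisenbergModule q) (k : ZMod q) (s : ℝ) (p : ℤ × ℤ) :
    ‖leftMono α a r p ξ k s‖ ≤ ∑ j, SchwartzMap.seminorm ℂ 0 0 (ξ j) := by
  rw [show p = (p.1, p.2) from rfl, leftMono_apply, norm_mul, norm_e, one_mul]
  exact norm_apply_le ξ _ _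

theorem rightAct_apply (ξ : HeisenbergModule q) (x : NCTorus α) (k : ZMod q) (s : ℝ) :
    rightAct r ξ x k s = ∑' p, x.coeff p * rightMono α r p ξ k s := rfl

theorem leftAct_apply (x : NCTorus (moritaParam α a b r q)) (ξ : HeisenbergModule q)
    (k : ZMod q) (s : ℝ) :
    leftAct x ξ k s = ∑' p, x.coeff p * leftMono α a r p ξ k s := rfl

theorem hasSum_rightAct (ξ : HeisenbergModule q) (x : NCTorus α) (k : ZMod q) :
    HasSum (fun p => x.coeff p • rightMono α r p ξ k) (rightAct r ξ x k) :=
  hasSum_schwartzSum _ _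

theorem hasSum_leftAct (x : NCTorus (moritaParam α a b r q)) (ξ : HeisenbergModule q)
    (k : ZMod q) : HasSum (fun p => x.coeff p • leftMono α a r p ξ k) (leftAct x ξ k) :=
  hasSum_schwartzSum _ _

theorem rightAct_add (ξ : HeisenbergModule q) (x y : NCTorus α) :
    rightAct r ξ (x + y) = rightAct r ξ x + rightAct r ξ y := by
  funext k
  refine (hasSum_rightAct ξ (x + y) k).unique ?_
  rw [Pi.add_apply]
  convert (hasSum_rightAct ξ x k).add (hasSum_rightAct ξ y k) using 2 with p
  rw [NCTorus.coeff_add, add_smul]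

theorem rightAct_mul (ξ : HeisenbergModule q) (x y : NCTorus α) :
    rightAct r ξ (x * y) = rightAct r (rightAct r ξ x) y := by
  ext k s
  rw [rightAct_apply, rightAct_apply,
    NCTorus.tsum_coeff_mul' x y (norm_rightMono_le ξ k s)]
  refine tsum_congr fun z => ?_
  congr 1
  obtain ⟨z1, z2⟩ := z
  rw [rightMono_apply, rightAct_apply, ← tsum_mul_left]
  refine tsum_congr fun p => ?_
  have h := DFunLike.congr_fun (congrFun (rightMono_rightMono (α := α) (r := r) p (z1, z2) ξ) k) s
  rw [rightMono_apply] at h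
  simp only [Pi.smul_apply, smul_apply, smul_eq_mul] at h
  rw [← h]; ring

theorem leftAct_mul (hab : a * r + b * q = 1) (hε : eps α r q ≠ 0)
    (x y : NCTorus (moritaParam α a b r q)) (ξ : HeisenbergModule q) :
    leftAct (x * y) ξ = leftAct x (leftAct y ξ) := by
  ext k s
  rw [leftAct_apply, leftAct_apply, NCTorus.tsum_coeff_mul x y (norm_leftMono_le ξ k s)]
  refine tsum_congr fun z => ?_
  congr 1
  obtain ⟨z1, z2⟩ := z
  rw [leftMono_apply, leftAct_apply, ← tsum_mul_left]
  refine tsum_congr fun p => ?_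
  have h := DFunLike.congr_fun (congrFun (leftMono_leftMono hab hε (z1, z2) p ξ) k) s
  rw [leftMono_apply] at h
  simp only [Pi.smul_apply, smul_apply, smul_eq_mul] at h
  rw [← h]; ring

theorem rightAct_one (ξ : HeisenbergModule q) : rightAct r ξ (1 : NCTorus α) = ξ := by
  ext k s
  rw [rightAct_apply, tsum_eq_single 0 fun p hp => by simp [NCTorus.coeff_one, hp]]
  simp [NCTorus.coeff_one, rightMono_zero]

theorem leftAct_sub (x y : NCTorus (moritaParam α a b r q)) (ξ : HeisenbergModule q) :
    leftAct (x - y) ξ = leftAct x ξ - leftAct y ξ := by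
  funext k
  refine (hasSum_leftAct (x - y) ξ k).unique ?_
  rw [Pi.sub_apply]
  convert (hasSum_leftAct x ξ k).sub (hasSum_leftAct y ξ k) using 2 with p
  rw [NCTorus.coeff_sub, sub_smul]

theorem leftAct_zero (ξ : HeisenbergModule q) :
    leftAct (0 : NCTorus (moritaParam α a b r q)) ξ = 0 := by
  ext k s
  rw [leftAct_apply]
  simp

/-! ### Leibniz rules -/

/-- The series converges in the Schwartz space and `∇̄` is continuous there, so the rule on
monomials can be summed term by term. -/
theorem nablaBar_rightAct (hε : eps α r q ≠ 0) (τ : ℂ) (ξ : HeisenbergModule q)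
    (x : NCTorus α) :
    nablaBar τ α r (rightAct r ξ x) =
      rightAct r (nablaBar τ α r ξ) x + rightAct r ξ (NCTorus.delBar τ x) := by
  funext k
  refine ((hasSum_rightAct ξ x k).mapL (nablaBarCLM τ α r q)).unique ?_
  rw [Pi.add_apply]
  convert (hasSum_rightAct (nablaBar τ α r ξ) x k).add
    (hasSum_rightAct ξ (NCTorus.delBar τ x) k) using 2 with p
  rw [map_smul, nablaBar_rightMono hε, smul_add, smul_smul]
  congr 2
  simp only [NCTorus.delBar, NCTorus.partial₁, NCTorus.partial₂, NCTorus.coeff_smul,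
    NCTorus.coeff_sub, NCTorus.coeff_mk]
  ring

theorem nablaBar_leftAct (τ : ℂ) (x : NCTorus (moritaParam α a b r q))
    (ξ : HeisenbergModule q) :
    nablaBar τ α r (leftAct x ξ) = leftAct x (nablaBar τ α r ξ) +
      (q * eps α r q : ℂ)⁻¹ • leftAct (NCTorus.delBar τ x) ξ := by
  funext k
  refine ((hasSum_leftAct x ξ k).mapL (nablaBarCLM τ α r q)).unique ?_
  rw [Pi.add_apply, Pi.smul_apply]
  convert (hasSum_leftAct x (nablaBar τ α r ξ) k).add
    ((hasSum_leftAct (NCTorus.delBar τ x) ξ k).const_smul (q * eps α r q : ℂ)⁻¹) using 2 with p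
  rw [map_smul, nablaBar_leftMono, smul_add, smul_smul, smul_smul]
  congr 2
  simp only [NCTorus.delBar, NCTorus.partial₁, NCTorus.partial₂, NCTorus.coeff_smul,
    NCTorus.coeff_sub, NCTorus.coeff_mk]
  ring

/-! ### The `L²` inner product and the two hermitian structures -/

/-- The `L²` inner product on the Heisenberg module, antilinear in the first argument. -/
def innerL2 (ξ η : HeisenbergModule q) : ℂ := ∑ k, pairing (ξ k) (η k)

theorem conj_innerL2 (ξ η : HeisenbergModule q) : conj (innerL2 ξ η) = innerL2 η ξ := by
  simp only [innerL2, map_sum, conj_pairing]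

theorem innerL2_smul_left (c : ℂ) (ξ η : HeisenbergModule q) :
    innerL2 (c • ξ) η = conj c * innerL2 ξ η := by
  simp only [innerL2, Pi.smul_apply, pairing_smul_left, Finset.mul_sum]

theorem innerL2_mono (c : ZMod q → ℝ) (x y : ℝ) (u : ZMod q) (ξ η : HeisenbergModule q) :
    innerL2 (fun k => e (c k) • shiftMod x y (ξ (k - u)))
      (fun k => e (c k) • shiftMod x y (η (k - u))) = innerL2 ξ η := by
  rw [innerL2, innerL2, ← Equiv.sum_comp (Equiv.subRight u) fun k => pairing (ξ k) (η k)]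
  refine Finset.sum_congr rfl fun k _ => ?_
  rw [pairing_smul_left, ← conj_pairing, pairing_smul_left, map_mul, Complex.conj_conj,
    conj_pairing, pairing_shiftMod, conj_e, ← mul_assoc, mul_comm (e _), e_mul_e_neg, one_mul]
  rfl

theorem innerL2_rightMono (p : ℤ × ℤ) (ξ η : HeisenbergModule q) :
    innerL2 (rightMono α r p ξ) (rightMono α r p η) = innerL2 ξ η :=
  innerL2_mono _ _ _ _ ξ η

theorem innerL2_leftMono (p : ℤ × ℤ) (ξ η : HeisenbergModule q) :
    innerL2 (leftMono α a r p ξ) (leftMono α a r p η) = innerL2 ξ η :=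
  innerL2_mono _ _ _ _ ξ η

theorem herm_rightAct (hε : eps α r q ≠ 0) (ξ η : HeisenbergModule q) (x : NCTorus α) :
    herm hε ξ (rightAct r η x) = herm hε ξ η * x := by
  refine NCTorus.ext fun p => ?_
  have h1 : HasSum (fun z => x.coeff z * innerL2 (rightMono α r p ξ) (rightMono α r z η))
      (innerL2 (rightMono α r p ξ) (rightAct r η x)) := by
    simp only [innerL2, Finset.mul_sum]
    refine hasSum_sum fun k _ => ?_
    have := (hasSum_rightAct (r := r) η x k).mapL (pairingCLM (rightMono α r p ξ k))
    simpa only [map_smul, smul_eq_mul, pairingCLM_apply] using this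
  refine h1.tsum_eq.symm.trans ?_
  rw [NCTorus.coeff_mul]
  refine Eq.trans ?_ ((Equiv.subLeft p).tsum_eq _)
  refine tsum_congr fun z => ?_
  -- Up to a phase, `ξ Z^p` is `(ξ Z^(p - z)) Z^z`; unitarity of `Z^z` then turns the inner product
  -- with `η Z^z` into the coefficient of `⟨ξ, η⟩` at `p - z`.
  have h2 := innerL2_rightMono (α := α) (r := r) z (rightMono α r (p - z) ξ) η
  rw [rightMono_rightMono, innerL2_smul_left, conj_e, sub_add_cancel] at h2
  change _ = innerL2 (rightMono α r (p - z) ξ) η * x.coeff (p - (p - z)) *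
    e (α * ((p - z).2 * (p.1 - (p - z).1)))
  rw [← h2]
  simp only [sub_sub_cancel, Prod.fst_sub, Prod.snd_sub, Int.cast_sub]
  linear_combination (-x.coeff z * innerL2 (rightMono α r p ξ) (rightMono α r z η)) *
    e_mul_e_neg (α * ((p.2 - z.2) * z.1))

theorem star_herm (hε : eps α r q ≠ 0) (ξ η : HeisenbergModule q) :
    star (herm hε ξ η) = herm hε η ξ := by
  refine NCTorus.ext fun p => ?_
  rw [NCTorus.coeff_star]
  change conj (innerL2 (rightMono α r (-p) ξ) η) * _ = innerL2 (rightMono α r p η) ξ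
  rw [conj_innerL2, ← innerL2_rightMono p η (rightMono α r (-p) ξ), rightMono_rightMono,
    neg_add_cancel, rightMono_zero, ← conj_innerL2, innerL2_smul_left, map_mul,
    Complex.conj_conj, conj_innerL2, mul_right_comm, ← e_add]
  simp [e_zero, mul_comm]

theorem herm_rightAct_left (hε : eps α r q ≠ 0) (ξ η : HeisenbergModule q) (x : NCTorus α) :
    herm hε (rightAct r ξ x) η = star x * herm hε ξ η := by
  rw [← star_herm, herm_rightAct, NCTorus.star_mul, star_herm]

end

section

/-! ### The left hermitian structure -/

theorem pairing_shiftMod_mulX (x y : ℝ) (f g : 𝓢(ℝ, ℂ)) :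
    pairing (shiftMod x y f) (mulX g) =
      pairing (shiftMod x y (mulX f)) g + x * pairing (shiftMod x y f) g := by
  rw [← pairing_mulX, mulX_shiftMod, pairing_add_left, pairing_smul_left, Complex.conj_ofReal]

theorem pairing_shiftMod_deriv (x y : ℝ) (f g : 𝓢(ℝ, ℂ)) :
    -pairing (shiftMod x y f) (SchwartzMap.derivCLM ℂ ℂ g) =
      pairing (shiftMod x y (SchwartzMap.derivCLM ℂ ℂ f)) g +
        conj (2 * Real.pi * Complex.I * y) * pairing (shiftMod x y f) g := by
  rw [← pairing_deriv, deriv_shiftMod, pairing_add_left, pairing_smul_left]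

/-- The matrix coefficients of a phase-space lattice decay rapidly. -/
theorem rapidDecay_pairing_shiftMod {A B : ℝ} (hA : A ≠ 0) (hB : B ≠ 0) (f g : 𝓢(ℝ, ℂ)) :
    RapidDecay fun p => pairing (shiftMod (p.1 * A) (p.2 * B) f) g := by
  intro N
  induction N generalizing f g with
  | zero =>
    exact ⟨_, fun p => by simpa using norm_pairing_shiftMod_le f g (p.1 * A) (p.2 * B)⟩
  | succ N ih =>
    -- A factor `p.1 * A` comes from commuting multiplication by `s` past the translation, a factor
    -- `p.2 * B` from commuting `d/ds` past the modulation; moving these operators across the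
    -- pairing gains one power of the weight.
    obtain ⟨C0, h0⟩ := ih f g
    obtain ⟨C1, h1⟩ := ih f (mulX g)
    obtain ⟨C2, h2⟩ := ih (mulX f) g
    obtain ⟨C3, h3⟩ := ih f (SchwartzMap.derivCLM ℂ ℂ g)
    obtain ⟨C4, h4⟩ := ih (SchwartzMap.derivCLM ℂ ℂ f) g
    have hB' : 0 < 2 * Real.pi * |B| := by have := Real.pi_pos; positivity
    have hA' : 0 < |A| := abs_pos.mpr hA
    refine ⟨C0 + |A|⁻¹ * (C1 + C2) + (2 * Real.pi * |B|)⁻¹ * (C3 + C4), fun p => ?_⟩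
    have e1 := norm_sub_le (pairing (shiftMod (p.1 * A) (p.2 * B) f) (mulX g))
      (pairing (shiftMod (p.1 * A) (p.2 * B) (mulX f)) g)
    rw [sub_eq_of_eq_add' (pairing_shiftMod_mulX _ _ _ _), norm_mul, Complex.norm_real,
      Real.norm_eq_abs, abs_mul] at e1
    have e2 := norm_sub_le
      (-pairing (shiftMod (p.1 * A) (p.2 * B) f) (SchwartzMap.derivCLM ℂ ℂ g))
      (pairing (shiftMod (p.1 * A) (p.2 * B) (SchwartzMap.derivCLM ℂ ℂ f)) g)
    rw [sub_eq_of_eq_add' (pairing_shiftMod_deriv _ _ _ _), norm_mul, RCLike.norm_conj,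
      norm_neg] at e2
    simp only [norm_mul, Complex.norm_I, Complex.norm_ofNat, Complex.norm_real,
      Real.norm_eq_abs, abs_of_pos Real.pi_pos, mul_one] at e2
    have hw := pow_pos (weight_pos p) N
    specialize h0 p
    specialize h1 p
    specialize h2 p
    specialize h3 p
    specialize h4 p
    simp only at h0 h1 h2 h3 h4 ⊢
    set P := ‖pairing (shiftMod (p.1 * A) (p.2 * B) f) g‖
    set W := weight p ^ N
    have e1' : W * (|(p.1 : ℝ)| * P) ≤ |A|⁻¹ * (C1 + C2) := by
      rw [← div_eq_inv_mul, le_div_iff₀ hA']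
      nlinarith [mul_le_mul_of_nonneg_left e1 hw.le]
    have e2' : W * (|(p.2 : ℝ)| * P) ≤ (2 * Real.pi * |B|)⁻¹ * (C3 + C4) := by
      rw [← div_eq_inv_mul, le_div_iff₀ hB']
      nlinarith [mul_le_mul_of_nonneg_left e2 hw.le]
    calc weight p ^ (N + 1) * P = W * P + W * (|(p.1 : ℝ)| * P) + W * (|(p.2 : ℝ)| * P) := by
          rw [pow_succ]
          nth_rewrite 2 [weight]
          ring
      _ ≤ _ := by linarith

variable {q : ℕ} [NeZero q] {α : ℝ} {a b r : ℤ}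

theorem rapidDecay_innerL2_leftMono (hε : eps α r q ≠ 0) (ξ η : HeisenbergModule q) :
    RapidDecay fun p => innerL2 (leftMono α a r p η) ξ := by
  have hq : (q : ℝ) ≠ 0 := by exact_mod_cast NeZero.ne q
  intro N
  choose C hC using fun j k : ZMod q => rapidDecay_pairing_shiftMod (inv_ne_zero hq)
    (inv_ne_zero (mul_ne_zero hε hq)) (η j) (ξ k) N
  refine ⟨∑ k, ∑ j, |C j k|, fun p => ?_⟩
  have hw := pow_pos (weight_pos p) N
  calc weight p ^ N * ‖innerL2 (leftMono α a r p η) ξ‖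
      ≤ weight p ^ N * ∑ k, ‖pairing (leftMono α a r p η k) (ξ k)‖ := by
        gcongr; exact norm_sum_le _ _
    _ ≤ _ := by
        rw [Finset.mul_sum]
        refine Finset.sum_le_sum fun k _ => ?_
        rw [leftMono, pairing_smul_left, norm_mul, RCLike.norm_conj, norm_e, one_mul]
        exact ((hC _ k p).trans (le_abs_self _)).trans
          (Finset.single_le_sum (f := fun j => |C j k|) (fun _ _ => abs_nonneg _)
            (Finset.mem_univ (k - (p.1 : ZMod q))))

/-- The `A_θ`-valued hermitian structure on the Heisenberg module, antilinear in the second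
argument. -/
def leftHerm (hε : eps α r q ≠ 0) (ξ η : HeisenbergModule q) :
    NCTorus (moritaParam α a b r q) :=
  ((|q * eps α r q|⁻¹ : ℝ) : ℂ) • NCTorus.mk (fun p => innerL2 (leftMono α a r p η) ξ)
    (rapidDecay_innerL2_leftMono hε ξ η)

theorem coeff_leftHerm (hε : eps α r q ≠ 0) (ξ η : HeisenbergModule q) (p : ℤ × ℤ) :
    (leftHerm hε ξ η : NCTorus (moritaParam α a b r q)).coeff p =
      ((|q * eps α r q|⁻¹ : ℝ) : ℂ) * innerL2 (leftMono α a r p η) ξ := rfl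

theorem star_leftHerm (hab : a * r + b * q = 1) (hε : eps α r q ≠ 0)
    (ξ η : HeisenbergModule q) :
    star (leftHerm hε ξ η : NCTorus (moritaParam α a b r q)) = leftHerm hε η ξ := by
  refine NCTorus.ext fun p => ?_
  rw [NCTorus.coeff_star, coeff_leftHerm, coeff_leftHerm, map_mul, Complex.conj_ofReal,
    conj_innerL2, ← innerL2_leftMono p ξ (leftMono α a r (-p) η),
    leftMono_leftMono hab hε, add_neg_cancel, leftMono_zero, ← conj_innerL2,
    innerL2_smul_left, map_mul, Complex.conj_conj, conj_innerL2, mul_assoc, mul_right_comm,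
    ← e_add]
  simp [e_zero, mul_comm]

/-- `(conjMulS x f g)(s) = conj (f(s - x)) g(s)`. -/
def conjMulS (x : ℝ) (f g : 𝓢(ℝ, ℂ)) : 𝓢(ℝ, ℂ) :=
  SchwartzMap.pairing (ContinuousLinearMap.mul ℂ ℂ) (conjS (f.compSubConstCLM ℂ x)) g

theorem conjMulS_apply (x : ℝ) (f g : 𝓢(ℝ, ℂ)) (s : ℝ) :
    conjMulS x f g s = conj (f (s - x)) * g s := rfl

/-- For fixed `m` the sum over powers of `Z₂` is a Fourier series; Poisson summation makes it a sum
over the translates by powers of `U₁`. -/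
theorem tsum_herm_mul (ξ η : HeisenbergModule q) (k : ZMod q) (s : ℝ) (m : ℤ) :
    ∑' n : ℤ, hermCoeff α r ξ η (m, n) * e (n * (s - k.val / q)) =
      ∑' u : ℤ, conj (ξ (k - u - (m * r : ℤ)) (s - u / q - m * eps α r q)) *
        η (k - u) (s - u / q) := by
  have h := tsum_heisenberg_eq
    (fun j => conjMulS (m * eps α r q) (ξ (j - ((m * r : ℤ) : ZMod q))) (η j)) k s
  simp only [conjMulS_apply] at h
  simp only [hermCoeff_eq]
  rw [h, ← (Equiv.neg ℤ).tsum_eq]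
  refine tsum_congr fun u => ?_
  simp only [Equiv.neg_apply, Int.cast_neg, neg_div, ← sub_eq_add_neg]

/-- The mirror statement: with `c = q ε` the lattice generated by `(c / q, r)` is that of the
translations `Z₁`. The Jacobian `|c|⁻¹` is what fixes the normalisation of `leftHerm`. -/
theorem tsum_leftHerm_mul (hab : a * r + b * q = 1) (hε : eps α r q ≠ 0)
    (ξ η : HeisenbergModule q) (k : ZMod q) (s : ℝ) (u : ℤ) :
    ∑' v : ℤ, (leftHerm hε ξ η : NCTorus (moritaParam α a b r q)).coeff (u, v) *
        e (v * (((s - u / q) / eps α r q - a * (k - (u : ZMod q)).val) / q)) =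
      ∑' m : ℤ, conj (η (k - u - (m * r : ℤ)) (s - u / q - m * eps α r q)) *
        ξ (k - (m * r : ℤ)) (s - m * eps α r q) := by
  have hq : (q : ℝ) ≠ 0 := by exact_mod_cast NeZero.ne q
  have hc : q * eps α r q ≠ 0 := mul_ne_zero hq hε
  have h := tsum_heisenberg_eq_of_dilate hab hc
    (fun j => conjMulS (u / q) (η (j - (u : ZMod q))) (ξ j)) k s
  simp only [conjMulS_apply] at h
  -- The phase due to the translation by `u` depends on neither `t` nor `j`; it occurs once
  -- conjugated in the coefficient and once in the character, so it cancels.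
  let w : ℤ → ℂ := fun v => e (v * ((a * u - u / q / eps α r q) / q))
  have hw : ∀ (v : ℤ) (j : ZMod q) (t : ℝ),
      e (v * (((t - u / q) / eps α r q - a * (j - (u : ZMod q)).val) / q)) =
        w v * e (v * (t / (q * eps α r q) - a * j.val / q)) := by
    intro v j t
    obtain ⟨l, hl⟩ := exists_val_sub j u
    rw [← e_add]
    refine e_eq_of_sub_eq_intCast (-(v * a * l)) ?_
    rw [hl]; push_cast; field_simp; ring
  have hw1 : ∀ v, conj (w v) * w v = 1 := fun v => by
    rw [conj_e, mul_comm, e_mul_e_neg]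
  refine Eq.trans (tsum_congr fun v => ?_) (h.trans ?_)
  · rw [hw, coeff_leftHerm, ← mul_assoc]
    congr 1
    rw [mul_assoc]
    congr 1
    rw [innerL2, Finset.sum_mul]
    refine Finset.sum_congr rfl fun j _ => ?_
    rw [pairing, ← MeasureTheory.integral_mul_const]
    congr 1; funext t
    rw [leftMono_apply, hw, map_mul, map_mul, conj_e (_ * (_ - _))]
    linear_combination (e (-(v * (t / (q * eps α r q) - a * j.val / q))) *
      conj (η (j - (u : ZMod q)) (t - u / q)) * ξ j t) * hw1 v
  · rw [← (Equiv.neg ℤ).tsum_eq]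
    refine tsum_congr fun m => ?_
    have h2 : k + ((-m * r : ℤ) : ZMod q) = k - ((m * r : ℤ) : ZMod q) := by push_cast; ring
    have h3 : s + ((-m : ℤ) : ℝ) * (q * eps α r q / q) = s - m * eps α r q := by
      push_cast; field_simp; ring
    simp only [Equiv.neg_apply, h2, h3, sub_right_comm s, sub_right_comm k]

/-- The fundamental identity relating the two hermitian structures. -/
theorem leftAct_leftHerm (hab : a * r + b * q = 1) (hε : eps α r q ≠ 0)
    (ξ η ζ : HeisenbergModule q) :
    leftAct (leftHerm hε ξ η : NCTorus (moritaParam α a b r q)) ζ =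
      rightAct r ξ (herm hε η ζ) := by
  have hq : (q : ℝ) ≠ 0 := by exact_mod_cast NeZero.ne q
  ext k s
  let D : ℤ → ℤ → ℂ := fun m u =>
    conj (η (k - u - (m * r : ℤ)) (s - u / q - m * eps α r q)) * ζ (k - u) (s - u / q) *
      ξ (k - (m * r : ℤ)) (s - m * eps α r q)
  have hsζ : Summable fun u : ℤ => ‖ζ (k - u) (s - u / q)‖ := by
    refine (summable_norm_progression_zmod ζ (fun u => k - u) s
      (neg_ne_zero.2 (inv_ne_zero hq))).congr fun u => ?_
    congr 2; ring
  have hsξ : Summable fun m : ℤ => ‖ξ (k - (m * r : ℤ)) (s - m * eps α r q)‖ := by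
    refine (summable_norm_progression_zmod ξ (fun m => k - (m * r : ℤ)) s
      (neg_ne_zero.2 hε)).congr fun u => ?_
    congr 2; ring
  -- `η` is bounded, while `ξ` is summable along the `m`-progression and `ζ` along the
  -- `u`-progression; this justifies exchanging the two sums.
  have hD : Summable (Function.uncurry D) := by
    refine Summable.of_norm_bounded ((hsξ.mul_of_nonneg hsζ (fun _ => norm_nonneg _)
      (fun _ => norm_nonneg _)).mul_left (∑ j, SchwartzMap.seminorm ℂ 0 0 (η j))) fun x => ?_
    simp only [Function.uncurry, D, norm_mul, RCLike.norm_conj]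
    calc _ ≤ (∑ j, SchwartzMap.seminorm ℂ 0 0 (η j)) * ‖ζ (k - x.2) (s - x.2 / q)‖ *
          ‖ξ (k - (x.1 * r : ℤ)) (s - x.1 * eps α r q)‖ := by
          gcongr; exact norm_apply_le η _ _
      _ = _ := by ring
  have hL : leftAct (leftHerm hε ξ η : NCTorus (moritaParam α a b r q)) ζ k s =
      ∑' u, ∑' m, D m u := by
    rw [leftAct_apply, (NCTorus.summable_coeff_mul _ (norm_leftMono_le ζ k s)).tsum_prod]
    refine tsum_congr fun u => ?_
    simp only [leftMono_apply, ← mul_assoc]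
    rw [tsum_mul_right, tsum_leftHerm_mul hab hε, ← tsum_mul_right]
    refine tsum_congr fun m => ?_
    simp only [D]; ring
  have hR : rightAct r ξ (herm hε η ζ) k s = ∑' m, ∑' u, D m u := by
    rw [rightAct_apply, (NCTorus.summable_coeff_mul _ (norm_rightMono_le ξ k s)).tsum_prod]
    refine tsum_congr fun m => ?_
    simp only [rightMono_apply, ← mul_assoc]
    rw [tsum_mul_right]
    change (∑' n : ℤ, hermCoeff α r η ζ (m, n) * _) * _ = _
    rw [tsum_herm_mul, ← tsum_mul_right]
  rw [hL, hR]
  exact hD.tsum_comm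

/-! ### Faithfulness of the left action -/

/-- An absolutely convergent Fourier series that vanishes has vanishing coefficients. -/
theorem eq_zero_of_tsum_mul_e_eq_zero {c : ℤ → ℂ} (hc : Summable fun n => ‖c n‖)
    (h : ∀ t : ℝ, ∑' n, c n * e (n * t) = 0) (n : ℤ) : c n = 0 := by
  have hs : Summable fun n => c n • (fourier n : C(UnitAddCircle, ℂ)) :=
    Summable.of_norm (by simpa [norm_smul, fourier_norm] using hc)
  -- The series converges uniformly on the circle and its sum vanishes at each point. Pairing it in
  -- `L²` with a Fourier monomial then extracts one coefficient.
  have h0 : HasSum (fun n => c n • (fourier n : C(UnitAddCircle, ℂ))) 0 := by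
    convert hs.hasSum
    ext t
    induction t using QuotientAddGroup.induction_on with
    | H t =>
      have h1 := (hs.hasSum.mapL (ContinuousMap.evalCLM ℂ (t : UnitAddCircle))).tsum_eq
      simp only [ContinuousMap.evalCLM_apply] at h1
      rw [ContinuousMap.zero_apply]
      refine Eq.trans ?_ h1
      rw [← h t]
      refine tsum_congr fun n => ?_
      rw [ContinuousMap.smul_apply, smul_eq_mul, e]
      erw [fourier_coe_apply]
      congr 2; push_cast; ring
  have h2 := (h0.mapL (ContinuousMap.toLp 2 AddCircle.haarAddCircle ℂ)).mapL
    (innerSL ℂ (fourierLp 2 n))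
  simp only [map_smul, map_zero] at h2
  have h3 := h2.tsum_eq
  rw [tsum_eq_single n] at h3
  · have := (orthonormal_fourier (T := 1)).1 n
    change c n • inner ℂ (fourierLp 2 n) (fourierLp 2 n) = 0 at h3
    rw [inner_self_eq_norm_sq_to_K, this] at h3
    simpa using h3
  · intro m hm
    have := (orthonormal_fourier (T := 1)).2 (Ne.symm hm)
    change c m • inner ℂ (fourierLp 2 n) (fourierLp 2 m) = 0
    rw [this, smul_zero]

theorem exists_schwartz_bump (x : ℝ) {R : ℝ} (hR : 0 < R) :
    ∃ f : 𝓢(ℝ, ℂ), f x = 1 ∧ ∀ y, R ≤ |y - x| → f y = 0 := by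
  let B : ContDiffBump x := ⟨R / 2, R, by positivity, by linarith⟩
  have h1 : ContDiff ℝ ∞ fun y => (B y : ℂ) := Complex.ofRealCLM.contDiff.comp B.contDiff
  have h2 : HasCompactSupport fun y => (B y : ℂ) :=
    B.hasCompactSupport.comp_left (g := fun y : ℝ => (y : ℂ)) Complex.ofReal_zero
  refine ⟨h2.toSchwartzMap h1, ?_, fun y hy => ?_⟩
  · change (B x : ℂ) = 1
    rw [B.one_of_mem_closedBall (by simp [B]; positivity), Complex.ofReal_one]
  · change (B y : ℂ) = 0
    rw [B.zero_of_le_dist (by simpa [B, Real.dist_eq] using hy), Complex.ofReal_zero]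

theorem eq_zero_of_leftAct_eq_zero (hε : eps α r q ≠ 0)
    (x : NCTorus (moritaParam α a b r q)) (hx : ∀ ξ, leftAct x ξ = 0) : x = 0 := by
  have hq : (q : ℝ) ≠ 0 := by exact_mod_cast NeZero.ne q
  have hq0 : (0 : ℝ) < q := by exact_mod_cast NeZero.pos q
  refine NCTorus.ext fun p => ?_
  obtain ⟨u, v⟩ := p
  refine eq_zero_of_tsum_mul_e_eq_zero (c := fun v => x.coeff (u, v))
    (x.rapid.summable_norm.prod_factor u) (fun t => ?_) v
  -- Evaluating at residue `u` and position `t ε q + u / q` makes the phase of `U₂ᵛ` in the `u`-term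
  -- exactly `e (v t)`. Other powers of `U₁` move the argument of `f` at least `1 / q` from its
  -- centre, where `f` vanishes.
  obtain ⟨f, hf1, hf0⟩ := exists_schwartz_bump (t * (eps α r q * q)) (inv_pos.2 hq0)
  have h := DFunLike.congr_fun (congrFun (hx fun _ => f) (u : ZMod q))
    (t * (eps α r q * q) + u / q)
  rw [leftAct_apply, (NCTorus.summable_coeff_mul x (norm_leftMono_le _ _ _)).tsum_prod,
    tsum_eq_single u] at h
  · refine Eq.trans (tsum_congr fun n => ?_) h
    rw [leftMono_apply, add_sub_cancel_right, hf1, sub_self, ZMod.val_zero]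
    rw [mul_one]
    congr 2
    push_cast
    field_simp
    ring
  · intro m hm
    refine (tsum_congr fun n => ?_).trans tsum_zero
    rw [leftMono_apply, hf0, mul_zero, mul_zero]
    have hm' : (1 : ℝ) ≤ |((u - m : ℤ) : ℝ)| := by
      exact_mod_cast Int.one_le_abs (sub_ne_zero.2 (Ne.symm hm))
    rw [show t * (eps α r q * q) + u / q - m / q - t * (eps α r q * q) =
      ((u - m : ℤ) : ℝ) * (q : ℝ)⁻¹ by push_cast; ring, abs_mul, abs_of_pos (inv_pos.2 hq0)]
    exact le_mul_of_one_le_left (inv_pos.2 hq0).le hm'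

theorem leftAct_injective (hε : eps α r q ≠ 0) {x y : NCTorus (moritaParam α a b r q)}
    (h : ∀ ξ, leftAct x ξ = leftAct y ξ) : x = y :=
  sub_eq_zero.1 (eq_zero_of_leftAct_eq_zero hε _ fun ξ => by rw [leftAct_sub, h, sub_self])

end

section

variable {q : ℕ} [NeZero q] {α : ℝ} {a b r : ℤ}

/-! ### The projection attached to a frame -/

theorem NCTorus.star_inv_of_star_eq {θ : ℝ} (h : (NCTorus θ)ˣ)
    (hs : star (h : NCTorus θ) = h) : star (↑h⁻¹ : NCTorus θ) = ↑h⁻¹ := by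
  have h1 : star (↑h⁻¹ : NCTorus θ) * h = 1 := by
    conv_lhs => rw [← hs, ← star_mul, Units.mul_inv, star_one]
  exact (Units.inv_eq_of_mul_eq_one_left h1).symm

/-- The element `|ψ⟩⟨ψ, ψ⟩⁻¹⟨ψ|` of `A_θ`, where `h = ⟨ψ, ψ⟩`. -/
def frameProj (hε : eps α r q ≠ 0) (ψ : HeisenbergModule q) (h : (NCTorus α)ˣ) :
    NCTorus (moritaParam α a b r q) :=
  leftHerm hε (rightAct r ψ (↑h⁻¹ : NCTorus α)) ψ

theorem leftAct_frameProj (hab : a * r + b * q = 1) (hε : eps α r q ≠ 0)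
    (ψ : HeisenbergModule q) (h : (NCTorus α)ˣ) (η : HeisenbergModule q) :
    leftAct (frameProj hε ψ h : NCTorus (moritaParam α a b r q)) η = ketBra hε ψ ↑h⁻¹ η := by
  rw [frameProj, leftAct_leftHerm hab, ketBra, rightAct_mul]

/-- By right linearity of `herm`, `h⁻¹ ⟨ψ, ψ c⟩ = h⁻¹ h c = c`. -/
theorem leftAct_frameProj_rightAct (hab : a * r + b * q = 1) (hε : eps α r q ≠ 0)
    (ψ : HeisenbergModule q) (h : (NCTorus α)ˣ) (hh : (h : NCTorus α) = herm hε ψ ψ)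
    (c : NCTorus α) :
    leftAct (frameProj hε ψ h : NCTorus (moritaParam α a b r q)) (rightAct r ψ c) =
      rightAct r ψ c := by
  rw [leftAct_frameProj hab, ketBra, herm_rightAct, ← hh, Units.inv_mul_cancel_left]

theorem frameProj_mul_self (hab : a * r + b * q = 1) (hε : eps α r q ≠ 0)
    (ψ : HeisenbergModule q) (h : (NCTorus α)ˣ) (hh : (h : NCTorus α) = herm hε ψ ψ) :
    (frameProj hε ψ h * frameProj hε ψ h : NCTorus (moritaParam α a b r q)) =
      frameProj hε ψ h := by
  refine leftAct_injective hε fun ξ => ?_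
  rw [leftAct_mul hab hε]
  nth_rewrite 2 [leftAct_frameProj hab]
  rw [ketBra, leftAct_frameProj_rightAct hab hε ψ h hh, leftAct_frameProj hab, ketBra]

theorem star_frameProj (hab : a * r + b * q = 1) (hε : eps α r q ≠ 0)
    (ψ : HeisenbergModule q) (h : (NCTorus α)ˣ) (hh : (h : NCTorus α) = herm hε ψ ψ) :
    star (frameProj hε ψ h : NCTorus (moritaParam α a b r q)) = frameProj hε ψ h := by
  refine leftAct_injective hε fun ξ => ?_
  have hs : star (h : NCTorus α) = h := by rw [hh, star_herm]
  rw [leftAct_frameProj hab, frameProj, star_leftHerm hab, leftAct_leftHerm hab,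
    herm_rightAct_left, NCTorus.star_inv_of_star_eq h hs, ketBra]

theorem delBar_frameProj_mul_eq_zero_iff (hab : a * r + b * q = 1) (hε : eps α r q ≠ 0) (τ : ℂ)
    (ψ : HeisenbergModule q) (h : (NCTorus α)ˣ) (hh : (h : NCTorus α) = herm hε ψ ψ) :
    NCTorus.delBar τ (frameProj hε ψ h : NCTorus (moritaParam α a b r q)) *
        frameProj hε ψ h = 0 ↔
      ∃ l : NCTorus α, nablaBar τ α r ψ - rightAct r ψ l = 0 := by
  set p : NCTorus (moritaParam α a b r q) := frameProj hε ψ h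
  have hc : (q * eps α r q : ℂ)⁻¹ ≠ 0 := by
    have hq : (q : ℂ) ≠ 0 := by exact_mod_cast NeZero.ne q
    exact inv_ne_zero (mul_ne_zero hq (by exact_mod_cast hε))
  have hp : ∀ c, leftAct p (rightAct r ψ c) = rightAct r ψ c :=
    leftAct_frameProj_rightAct hab hε ψ h hh
  constructor
  · intro h0
    have hψ : leftAct p ψ = ψ := by simpa only [rightAct_one] using hp 1
    have h1 : leftAct (NCTorus.delBar τ p) ψ = 0 := by
      rw [← hψ, ← leftAct_mul hab hε, h0, leftAct_zero]
    have h2 := nablaBar_leftAct τ p ψ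
    rw [hψ, h1, smul_zero, add_zero, leftAct_frameProj hab] at h2
    -- The witness is `λ = h⁻¹ ⟨ψ, ∇̄ψ⟩`, read off from `∇̄ψ = p ∇̄ψ`.
    exact ⟨_, sub_eq_zero.2 h2⟩
  · rintro ⟨l, hl⟩
    rw [sub_eq_zero] at hl
    refine eq_zero_of_leftAct_eq_zero hε _ fun η => ?_
    rw [leftAct_mul hab hε, leftAct_frameProj hab, ketBra]
    set c := (↑h⁻¹ : NCTorus α) * herm hε ψ η
    -- Here `∇̄(ψ c) = ψ (λ c + ∂̄ c)` is fixed by `p`, as is `ψ c`, so the Leibniz rule leaves only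
    -- `(q ε)⁻¹ ∂̄(p) (ψ c) = 0`.
    have h2 := nablaBar_leftAct τ p (rightAct r ψ c)
    rw [hp, nablaBar_rightAct hε, hl, ← rightAct_mul, ← rightAct_add, hp,
      left_eq_add, smul_eq_zero] at h2
    exact h2.resolve_left hc

end

end NCSigma

end

/-! ### Existence, uniqueness and the two self-duality equations. -/

theorem mainTheorem4 (α : ℝ) (a b r : ℤ) (q : ℕ) [NeZero q] (hab : a * r + b * q = 1)
    (hε : NCSigma.eps α r q ≠ 0) (τ : ℂ) (hτ : 0 < τ.im) (ψ : NCSigma.HeisenbergModule q)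
    (h : (NCSigma.NCTorus α)ˣ) (hh : (h : NCSigma.NCTorus α) = NCSigma.herm hε ψ ψ) :
    ∃ p : NCSigma.NCTorus (NCSigma.moritaParam α a b r q),
      (∀ x : NCSigma.NCTorus (NCSigma.moritaParam α a b r q),
        (∀ η, NCSigma.leftAct x η = NCSigma.ketBra hε ψ ↑h⁻¹ η) ↔ x = p) ∧
      p * p = p ∧ star p = p ∧
      (NCSigma.NCTorus.delBar τ p * p = 0 ↔
        ∃ l : NCSigma.NCTorus α,
          NCSigma.nablaBar τ α r ψ - NCSigma.rightAct r ψ l = 0) ∧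
      (p * NCSigma.NCTorus.del τ p = 0 ↔
        ∃ l : NCSigma.NCTorus α,
          NCSigma.nablaBar τ α r ψ - NCSigma.rightAct r ψ l = 0) := by
  have hps := NCSigma.star_frameProj hab hε ψ h hh
  have hd := NCSigma.delBar_frameProj_mul_eq_zero_iff hab hε τ ψ h hh
  refine ⟨NCSigma.frameProj hε ψ h, fun x => ⟨fun hx => ?_, ?_⟩,
    NCSigma.frameProj_mul_self hab hε ψ h hh, hps, hd, ?_⟩
  · exact NCSigma.leftAct_injective hε fun η => by
      rw [hx, NCSigma.leftAct_frameProj hab]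
  · rintro rfl η
    exact NCSigma.leftAct_frameProj hab hε ψ h η
  · rw [← hd]
    -- The star exchanges `∂` and `∂̄` and fixes `p`, so the two forms of the equation are adjoint
    -- to each other.
    have hs : star (NCSigma.frameProj hε ψ h * NCSigma.NCTorus.del τ
        (NCSigma.frameProj hε ψ h) : NCSigma.NCTorus (NCSigma.moritaParam α a b r q)) =
        NCSigma.NCTorus.delBar τ (NCSigma.frameProj hε ψ h) * NCSigma.frameProj hε ψ h := by
      rw [NCSigma.NCTorus.star_mul, NCSigma.NCTorus.star_del, hps]
    rw [← hs]
    constructor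
    · intro h0
      rw [h0, NCSigma.NCTorus.star_zero]
    · intro h0
      rw [← NCSigma.NCTorus.star_star (_ * _), h0, NCSigma.NCTorus.star_zero]
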